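/- Let $G$ be a group and $m\in\mathbb N\cup\{\infty\}$ ($0\in\mathbb N$). Conventions. A character of $G$ is a homomorphism $\chi:G\to\mathbb R$; $S(G)$ is the set of classes $[\chi]$ of non-zero characters modulo multiplication by positive reals, and $G_\chi=\{g\in G\mid\chi(g)\ge 0\}$. A monoid $M$ is of type $\mathrm{FP}_m$ if the trivial left $\mathbb ZM$-module $\mathbb Z$ has a projective resolution $P_*$ with $P_i$ finitely generated for all $i\le m$; $\Sigma^m(G,\mathbb Z)\subseteq S(G)$ is the set of $[\chi]$ such that $G_\chi$ is of type $\mathrm{FP}_m$. For a monoid $M$, the orbit category $\mathcal O_{\mathcal F}M$ has as objects the left $M$-sets $M/K=\{mK\mid m\in M\}$ with $K$ a finite subgroup of $M$, and as morphisms the $M$-maps. A Bredon module over $M$ is a contravariant functor $U$ from $\mathcal O_{\mathcal F}M$ to abelian groups. It is finitely generated if there are finite sets $S_K\subseteq U(M/K)$, empty for all but finitely many $K$, that are contained in no proper submodule of $U$. It is of type $\underline{\mathrm{FP}}_m$ if it has a projective resolution by Bredon modules $P_*$ with $P_i$ finitely generated for all $i\le m$. $\underline{\mathbb Z}$ is the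 constant Bredon module with value $\mathbb Z$. $M$ conjugates finite subgroups if, whenever $H_1g=gH_2$ with $H_1,H_2$ finite subgroups of $M$ and $g\in M$, there is an invertible $h\in M$ with $h^{-1}H_1h=H_2$. Finally, $\underline\Sigma^m(G,\underline{\mathbb Z})\subseteq S(G)$ is the set of $[\chi]$ for which there is a subgroup $\widetilde G$ of finite index in $G$ that contains the commutator subgroup $G'$ and all finite subgroups of $G$, such that the monoid $M=\widetilde G_\chi=\{g\in\widetilde G\mid\chi(g)\ge0\}$ conjugates finite subgroups and $\underline{\mathbb Z}$ is of type $\underline{\mathrm{FP}}_m$ as a Bredon module over $M$. Theorem. Let $G$ be finitely generated with finitely many conjugacy classes of finite subgroups, and let $\chi:G\to\mathbb R$ be a non-zero character. Then $[\chi]\in\underline\Sigma^m(G,\underline{\mathbb Z})$ if and only if there is a subgroup $\widetilde G$ of finite index in $G$ with $G'\le\widetilde G$ such that for every finite subgroup $K$ of $G$ we have $K\le\widetilde G$ and 1. $N_{\widetilde G}(K)\,(\ker\chi\cap\widetilde G)=\widetilde G$; 2. $\chi(N_G(K))\ne 0$ and $[\chi|_{N_G(K)}]\in\Sigma^m(N_G(K),\mathbb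 Z)$. The same equivalence holds with condition 2 replaced by 2b. $\chi(C_G(K))\ne 0$ and $[\chi|_{C_G(K)}]\in\Sigma^m(C_G(K),\mathbb Z)$. -/

import Mathlib

open CategoryTheory
open scoped Pointwise

universe u

/-! ### Finiteness type `FP_m` in an abelian category -/

/-- `A` is of type `FP_m` (`m` a natural number or `∞`), with respect to a notion `fg` of finitely
generated object: there is a projective resolution of `A` whose terms `P_i` are finitely generated
for all `i ≤ m`. -/
def IsOfTypeFP {C : Type*} [Category C] [Abelian C] (fg : C → Prop) (m : ℕ∞) (A : C) : Prop :=
  ∃ P : ProjectiveResolution A, ∀ i : ℕ, (i : ℕ∞) ≤ m → fg (P.complex.X i)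

/-- The trivial left `ℤM`-module `ℤ` of a monoid `M` (lifted to the universe of `M`). -/
noncomputable def trivialModule (M : Type u) [Monoid M] : ModuleCat.{u} (MonoidAlgebra ℤ M) :=
  ModuleCat.of (MonoidAlgebra ℤ M) (Representation.trivial ℤ M (ULift.{u} ℤ)).asModule

/-- The monoid `M` is of type `FP_m`: the trivial left module `ℤ` is of type `FP_m` over `ℤM`. -/
def MonoidIsFP (m : ℕ∞) (M : Type u) [Monoid M] : Prop :=
  IsOfTypeFP (fun P : ModuleCat.{u} (MonoidAlgebra ℤ M) => Module.Finite (MonoidAlgebra ℤ M) P)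
    m (trivialModule M)

/-! ### Bredon modules over a monoid, with respect to finite subgroups -/

/-- A finite subgroup of a monoid `M`. These are the objects of the orbit category. -/
structure FinSubgroup (M : Type u) [Monoid M] where
  /-- the underlying submonoid -/
  toSubmonoid : Submonoid M
  finite : Finite toSubmonoid
  exists_inv : ∀ x ∈ toSubmonoid, ∃ y ∈ toSubmonoid, x * y = 1 ∧ y * x = 1

namespace FinSubgroup

variable {M : Type u} [Monoid M]

/-- The underlying set of a finite subgroup. -/
def toSet (K : FinSubgroup M) : Set M := K.toSubmonoid

/-- The set `M/K = {mK | m ∈ M}` of left cosets. -/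
def Coset (K : FinSubgroup M) : Type u := {S : Set M // ∃ m : M, S = m • K.toSet}

/-- `M` acts on `M/K` by left multiplication. -/
instance (K : FinSubgroup M) : MulAction M K.Coset where
  smul a S := ⟨a • S.1, by
    obtain ⟨m, hm⟩ := S.2
    exact ⟨a * m, by rw [hm, mul_smul]⟩⟩
  one_smul S := Subtype.ext (one_smul M S.1)
  mul_smul a b S := Subtype.ext (mul_smul a b S.1)

/-- The orbit category `O_F M`: a morphism `K ⟶ H` is an `M`-map `M/K → M/H`. -/
instance : Category.{u} (FinSubgroup M) where
  Hom K H := K.Coset →[M] H.Coset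
  id K := MulActionHom.id M
  comp f g := g.comp f

end FinSubgroup

/-- Bredon modules over `M`: contravariant functors from the orbit category `O_F M` to abelian
groups. -/
abbrev BredonModule (M : Type u) [Monoid M] : Type (u + 1) :=
  (FinSubgroup M)ᵒᵖ ⥤ AddCommGrpCat.{u}

/-- A Bredon module `U` is finitely generated: there are finite sets `S K ⊆ U(M/K)`, empty for all
but finitely many `K`, such that every submodule of `U` which contains them is equal to `U`. -/
def BredonModule.IsFG {M : Type u} [Monoid M] (U : BredonModule M) : Prop :=
  ∃ S : ∀ K : (FinSubgroup M)ᵒᵖ, Set (U.obj K),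
    (∀ K, (S K).Finite) ∧ {K | (S K).Nonempty}.Finite ∧
    ∀ V : ∀ K : (FinSubgroup M)ᵒᵖ, AddSubgroup (U.obj K),
      (∀ (K H : (FinSubgroup M)ᵒᵖ) (f : K ⟶ H), ∀ x ∈ V K, U.map f x ∈ V H) →
      (∀ K, S K ⊆ V K) → ∀ K, V K = ⊤

/-- The trivial Bredon module `ℤ`: constant with value `ℤ`, all maps being the identity. -/
def trivialBredonModule (M : Type u) [Monoid M] : BredonModule M :=
  (Functor.const _).obj (AddCommGrpCat.of (ULift.{u} ℤ))

/-- The trivial Bredon module over `M` is of type (Bredon) `FP_m`. -/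
def MonoidIsBredonFP (m : ℕ∞) (M : Type u) [Monoid M] : Prop :=
  IsOfTypeFP (BredonModule.IsFG (M := M)) m (trivialBredonModule M)

/-- `M` conjugates finite subgroups: whenever `H₁ g = g H₂` for finite subgroups `H₁, H₂` and some
`g ∈ M`, there is an invertible `h ∈ M` with `h⁻¹ H₁ h = H₂`. -/
def ConjugatesFiniteSubgroups (M : Type u) [Monoid M] : Prop :=
  ∀ H₁ H₂ : FinSubgroup M,
    (∃ g : M, (fun x => x * g) '' H₁.toSet = (fun x => g * x) '' H₂.toSet) →
    ∃ h : Mˣ, (fun x => (↑h⁻¹ : M) * x * (h : M)) '' H₁.toSet = H₂.toSet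

/-- `G` has finitely many conjugacy classes of finite subgroups. -/
def FinitelyManyConjClassesFiniteSubgroups (G : Type u) [Group G] : Prop :=
  ∃ S : Set (Subgroup G), S.Finite ∧ (∀ K ∈ S, Finite K) ∧
    ∀ L : Subgroup G, Finite L → ∃ K ∈ S, ∃ g : G, L = MulAut.conj g • K

/-! ### Characters and the Sigma invariants -/

/-- Real characters of `G`, i.e. homomorphisms from `G` to the additive group of `ℝ`. -/
abbrev RealCharacter (G : Type u) [Group G] : Type u := Additive G →+ ℝ

namespace RealCharacter

variable {G : Type u} [Group G]

/-- The restriction of a character to a subgroup. -/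
def restrict (χ : RealCharacter G) (H : Subgroup G) : RealCharacter H :=
  χ.comp H.subtype.toAdditive

/-- The kernel of a character, a subgroup of `G`. -/
def kernel (χ : RealCharacter G) : Subgroup G := χ.toMultiplicativeRight.ker

/-- The monoid `G_χ = {g ∈ G | χ(g) ≥ 0}`. -/
def monoid (χ : RealCharacter G) : Submonoid G where
  carrier := {g | 0 ≤ χ (Additive.ofMul g)}
  one_mem' := by simp
  mul_mem' {a b} ha hb := by
    change 0 ≤ χ (Additive.ofMul (a * b))
    rw [ofMul_mul, map_add]
    exact add_nonneg ha hb

end RealCharacter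

/-- The character sphere `S(G)`: non-zero characters up to positive real multiples. -/
abbrev CharacterSphere (G : Type u) [Group G] : Type u := Module.Ray ℝ (RealCharacter G)

/-- The monoid `G_χ`, which depends only on the class `[χ]` in `S(G)`. -/
def CharacterSphere.monoid {G : Type u} [Group G] (c : CharacterSphere G) : Submonoid G :=
  Quotient.lift (fun χ : RayVector ℝ (RealCharacter G) => RealCharacter.monoid χ.1)
    (by
      intro χ ψ h
      obtain ⟨r, hr, e⟩ := SameRay.exists_pos_left (R := ℝ) h χ.2 ψ.2
      ext g
      change 0 ≤ χ.1 (Additive.ofMul g) ↔ 0 ≤ ψ.1 (Additive.ofMul g)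
      have e' : r * χ.1 (Additive.ofMul g) = ψ.1 (Additive.ofMul g) :=
        DFunLike.congr_fun e (Additive.ofMul g)
      rw [← e', mul_nonneg_iff_of_pos_left hr]) c

/-- The invariant `Σ^m(G, ℤ)`: the classes `[χ]` such that `ℤ` is of type `FP_m` over `ℤ G_χ`. -/
def SigmaInvariant (m : ℕ∞) (G : Type u) [Group G] : Set (CharacterSphere G) :=
  {c | MonoidIsFP m c.monoid}

/-- The Bredon invariant `Σ^m(G, ℤ)`: the classes `[χ]` for which there is a subgroup `G₁` of
finite index in `G` containing all finite subgroups and the commutator subgroup of `G`, such that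
the monoid `M = {g ∈ G₁ | χ(g) ≥ 0}` conjugates finite subgroups and the trivial Bredon module is
of type `FP_m` over `O_F M`. -/
def BredonSigma (m : ℕ∞) (G : Type u) [Group G] : Set (CharacterSphere G) :=
  {c | ∃ G₁ : Subgroup G, G₁.FiniteIndex ∧ (∀ K : Subgroup G, Finite K → K ≤ G₁) ∧
    commutator G ≤ G₁ ∧
    ConjugatesFiniteSubgroups (c.monoid.comap G₁.subtype) ∧
    MonoidIsBredonFP m (c.monoid.comap G₁.subtype)}

/-- `χ` is non-zero on the subgroup `H`, and the class of its restriction lies in `Σ^m(H, ℤ)`. -/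
def RestrictionInSigma {G : Type u} [Group G] (m : ℕ∞) (χ : RealCharacter G) (H : Subgroup G) :
    Prop :=
  ∃ h : χ.restrict H ≠ 0, rayOfNeZero ℝ (χ.restrict H) h ∈ SigmaInvariant m H

/-!
The proof reduces the Bredon condition over `M = G₁ ∩ G_χ` to the condition that the normalizers
`N_M(K)` of the finite subgroups `K` of `M` are of type `FP_m`, and compares these normalizers with
the monoids `N_G(K)_χ` and `C_G(K)_χ`.

*Bredon modules.* Evaluation at `M/K` turns a Bredon module into a module over `ℤ N_M(K)`, and is
exact. If `M` conjugates finite subgroups, the morphisms from `M/K` to `M/H` form finitely many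
`N_M(K)`-orbits with finite stabilizers (`FinSubgroup.permModule_hom`), so that the values of
finitely generated projective Bredon modules are of type `FP_n` for all `n`. Hence the values of a
Bredon resolution of `ℤ` show that `ℤ` is of type `FP_m` over `ℤ N_M(K)`
(`BredonModule.trivialModuleFP_normalizer`). Conversely, if every orbit is a retract of one of
finitely many orbits, finite generation of a Bredon module can be tested on its values, so that a
resolution of `ℤ` can be built from finitely generated free modules one syzygy at a time
(`BredonModule.monoidIsBredonFP_of_normalizer`).

*Conjugacy.* `M` conjugates finite subgroups if and only if `χ` takes the same values on
`N_{G₁}(K)` as on `G₁`, for all `K` (`conjugatesFiniteSubgroups_iff_normalizer`): elements that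
conjugate one finite subgroup to another can then be corrected by elements of the normalizer to lie
in `ker χ`. In the same way, the finitely many conjugacy classes of finite subgroups of `G` yield
the finitely many orbits over `M` (`exists_finite_retracts`).

*Finite index.* `N_M(K) = G₁ ∩ N_G(K)_χ`, and `C_G(K)` has finite index in `N_G(K)`. It remains to
see that type `FP_n` of a monoid `Γ_χ` can be tested on a normal subgroup `H` of finite index
(`RealCharacter.trivialModuleFP_iff`). From `H` to `Γ`, the permutation module `ℤ[Γ/H]` is induced
from the trivial module of `H_χ`, and the trivial module is resolved by powers of it over the
Noetherian ring `ℤ[Γ/H]`. From `Γ` to `H`, the difficulty is that `ℤΓ_χ` is in general neither free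
nor finitely generated over `ℤH_χ`. It is so up to multiplication by some `σ ∈ Γ_χ` with large
`χ(σ)`, which acts as the identity on `ℤ`; this suffices for the homomorphism `σ^k : ℤ → ℤ` to be of
type `FP_n` (`IsAlmostFiniteFree.linearMapFP_inclusion`).

Type `FP_n` is used in the recursive form `ModuleFP`, which `monoidIsFP_iff` compares with
projective resolutions.
-/

/-! ### Modules of type `FP_n` -/

/-- The module `A` is of type `FP_n`, described recursively: it is finitely generated, and for
`n > 0` it is the quotient of some `R^k` by a submodule of type `FP_{n-1}`. -/
def ModuleFP (R : Type u) [Ring R] : ∀ (_ : ℕ) (A : Type u) [AddCommGroup A] [Module R A], Prop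
  | 0, A, _, _ => Module.Finite R A
  | n + 1, A, _, _ => ∃ (k : ℕ) (f : (Fin k → R) →ₗ[R] A), Function.Surjective f ∧
      ModuleFP R n (LinearMap.ker f)

namespace ModuleFP

variable {R : Type u} [Ring R] {A B C : Type u} [AddCommGroup A] [Module R A]
  [AddCommGroup B] [Module R B] [AddCommGroup C] [Module R C]

theorem of_equiv {n : ℕ} (e : A ≃ₗ[R] B) (h : ModuleFP R n A) : ModuleFP R n B := by
  induction n generalizing A B with
  | zero => exact @Module.Finite.equiv _ _ _ _ _ _ _ _ h e
  | succ n ih =>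
    obtain ⟨k, f, hf, hk⟩ := h
    refine ⟨k, e.toLinearMap ∘ₗ f, e.surjective.comp hf, ih (LinearEquiv.ofEq _ _ ?_) hk⟩
    rw [LinearEquiv.ker_comp]

theorem finite {n : ℕ} (h : ModuleFP R n A) : Module.Finite R A := by
  cases n with
  | zero => exact h
  | succ n =>
    obtain ⟨k, f, hf, -⟩ := h
    exact Module.Finite.of_surjective f hf

theorem of_succ {n : ℕ} (h : ModuleFP R (n + 1) A) : ModuleFP R n A := by
  induction n generalizing A with
  | zero => exact h.finite
  | succ n ih =>
    obtain ⟨k, f, hf, hk⟩ := h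
    exact ⟨k, f, hf, ih hk⟩

theorem of_subsingleton (n : ℕ) [Subsingleton A] : ModuleFP R n A := by
  induction n generalizing A with
  | zero => exact inferInstanceAs (Module.Finite R A)
  | succ n ih => exact ⟨0, 0, fun x => ⟨0, Subsingleton.elim _ _⟩, ih⟩

/-- The class of modules of type `FP_n` is closed under extensions (horseshoe lemma). -/
theorem extension {n : ℕ} (f : A →ₗ[R] B) (g : B →ₗ[R] C) (hf : Function.Injective f)
    (hfg : Function.Exact f g) (hg : Function.Surjective g)
    (hA : ModuleFP R n A) (hC : ModuleFP R n C) : ModuleFP R n B := by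
  induction n generalizing A B C with
  | zero =>
    have : Module.Finite R A := hA
    have : Module.Finite R C := hC
    have h1 : (LinearMap.ker g).FG := by
      rw [LinearMap.exact_iff.1 hfg]
      exact Module.Finite.fg_top.map f |> fun h => by rwa [Submodule.map_top] at h
    have h2 : (Submodule.map g ⊤).FG := by
      rw [Submodule.map_top, LinearMap.range_eq_top.2 hg]; exact Module.Finite.fg_top
    exact ⟨Submodule.fg_of_fg_map_of_fg_inf_ker g h2 (by simpa using h1)⟩
  | succ n ih =>
    obtain ⟨k, p, hp, hkp⟩ := hA
    obtain ⟨l, q, hq, hkq⟩ := hC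
    obtain ⟨q', hq'⟩ := Module.projective_lifting_property g q hg
    let e : (Fin (k + l) → R) ≃ₗ[R] (Fin k → R) × (Fin l → R) :=
      (LinearEquiv.funCongrLeft R R finSumFinEquiv) ≪≫ₗ LinearEquiv.sumArrowLequivProdArrow _ _ R R
    let r : (Fin k → R) × (Fin l → R) →ₗ[R] B := (f ∘ₗ p).coprod q'
    have hgq (y) : g (q' y) = q y := LinearMap.congr_fun hq' y
    have hgf (x) : g (f x) = 0 := (hfg (f x)).2 ⟨x, rfl⟩
    have hr : Function.Surjective r := by
      intro b
      obtain ⟨y, hy⟩ := hq (g b)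
      obtain ⟨a, ha⟩ := (hfg (b - q' y)).1 (by simp [hgq, hy])
      obtain ⟨x, hx⟩ := hp a
      exact ⟨(x, y), by simp [r, hx, ha]⟩
    refine ⟨k + l, r ∘ₗ e.toLinearMap, hr.comp e.surjective, ?_⟩
    have key : ModuleFP R n (LinearMap.ker r) := by
      refine ih (A := LinearMap.ker p) (C := LinearMap.ker q)
        ((LinearMap.inl R _ _).restrict (p := LinearMap.ker p) (q := LinearMap.ker r) ?_)
        ((LinearMap.snd R _ _).restrict (p := LinearMap.ker r) (q := LinearMap.ker q) ?_) ?_ ?_ ?_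
        hkp hkq
      · intro x hx
        simp_all [r]
      · rintro ⟨x, y⟩ hx
        have : g (r (x, y)) = 0 := by rw [LinearMap.mem_ker.1 hx, map_zero]
        simpa [r, hgq, hgf] using this
      · rintro ⟨x, hx⟩ ⟨y, hy⟩ h
        exact Subtype.ext (congrArg (fun z => z.1.1) h)
      · rintro ⟨⟨x, y⟩, hx⟩
        constructor
        · intro h
          have hy : y = 0 := by simpa [LinearMap.restrict_apply] using h
          subst hy
          refine ⟨⟨x, ?_⟩, Subtype.ext rfl⟩
          have : f (p x) = 0 := by simpa [r] using hx
          exact hf (by rw [this, map_zero])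
        · rintro ⟨⟨z, hz⟩, h⟩
          exact Subtype.ext (congrArg (fun z => z.1.2) h).symm
      · rintro ⟨y, hy⟩
        obtain ⟨a, ha⟩ := (hfg (q' y)).1 (by rw [hgq]; exact hy)
        obtain ⟨x, hx⟩ := hp (-a)
        exact ⟨⟨(x, y), by simp [r, hx, ha]⟩, rfl⟩
    refine of_equiv (LinearEquiv.ofSubmodule' e (LinearMap.ker r)).symm ?_
    exact key

theorem pi_fin (n k : ℕ) : ModuleFP R n (Fin k → R) := by
  cases n with
  | zero => exact inferInstanceAs (Module.Finite R (Fin k → R))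
  | succ n =>
    refine ⟨k, LinearMap.id, Function.surjective_id, ?_⟩
    have : Subsingleton (LinearMap.ker (LinearMap.id : (Fin k → R) →ₗ[R] _)) := by
      rw [LinearMap.ker_id]; infer_instance
    exact of_subsingleton n

/-- The cokernel of a monomorphism between modules of type `FP_n` and `FP_{n+1}`. -/
theorem cokernel {n : ℕ} (f : A →ₗ[R] B) (g : B →ₗ[R] C) (hf : Function.Injective f)
    (hfg : Function.Exact f g) (hg : Function.Surjective g)
    (hA : ModuleFP R n A) (hB : ModuleFP R (n + 1) B) : ModuleFP R (n + 1) C := by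
  obtain ⟨k, p, hp, hkp⟩ := hB
  refine ⟨k, g ∘ₗ p, hg.comp hp, ?_⟩
  have hle : LinearMap.ker p ≤ LinearMap.ker (g ∘ₗ p) := LinearMap.ker_le_ker_comp p g
  let eA := LinearEquiv.ofInjective f hf
  have hAr : ModuleFP R n (LinearMap.range f) := hA.of_equiv eA
  have hgf (x) : g (f x) = 0 := (hfg (f x)).2 ⟨x, rfl⟩
  refine extension (Submodule.inclusion hle)
    (p.restrict (p := LinearMap.ker (g ∘ₗ p)) (q := LinearMap.range f) ?_)
    (Submodule.inclusion_injective hle) ?_ ?_ hkp hAr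
  · exact fun x hx => (hfg (p x)).1 hx
  · rintro ⟨x, hx⟩
    constructor
    · intro h
      exact ⟨⟨x, congrArg Subtype.val h⟩, rfl⟩
    · rintro ⟨⟨y, hy⟩, h⟩
      have h : y = x := congrArg Subtype.val h
      subst h
      exact Subtype.ext hy
  · rintro ⟨_, a, rfl⟩
    obtain ⟨x, hx⟩ := hp (f a)
    exact ⟨⟨x, by simp [hx, hgf]⟩, Subtype.ext hx⟩

theorem of_retract {n : ℕ} (i : A →ₗ[R] B) (r : B →ₗ[R] A) (h : r ∘ₗ i = LinearMap.id)
    (hB : ModuleFP R n B) : ModuleFP R n A := by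
  induction n generalizing A B with
  | zero =>
    exact @Module.Finite.of_surjective _ _ _ _ _ _ _ _ _ _ _ hB r
      fun x => ⟨i x, LinearMap.congr_fun h x⟩
  | succ n ih =>
    have hri (x) : r (i x) = x := LinearMap.congr_fun h x
    have hr : Function.Surjective r := fun x => ⟨i x, hri x⟩
    have hk : ModuleFP R n (LinearMap.ker r) := by
      refine ih (LinearMap.ker r).subtype
        ((LinearMap.id - i ∘ₗ r).codRestrict (LinearMap.ker r) fun x => by simp [hri]) ?_ hB.of_succ
      ext ⟨x, hx⟩
      simp [LinearMap.mem_ker.1 hx]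
    exact cokernel (LinearMap.ker r).subtype r Subtype.val_injective
      (LinearMap.exact_subtype_ker_map r) hr hk hB

theorem of_projective (n : ℕ) [Module.Finite R A] [Module.Projective R A] : ModuleFP R n A := by
  obtain ⟨k, f, hf⟩ := Module.Finite.exists_fin' R A
  obtain ⟨s, hs⟩ := Module.projective_lifting_property f LinearMap.id hf
  exact of_retract s f hs (pi_fin n k)

/-- The kernel of an epimorphism between modules of type `FP_n` and `FP_{n+1}`. -/
theorem kernel {n : ℕ} (f : A →ₗ[R] B) (g : B →ₗ[R] C) (hf : Function.Injective f)
    (hfg : Function.Exact f g) (hg : Function.Surjective g)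
    (hB : ModuleFP R n B) (hC : ModuleFP R (n + 1) C) : ModuleFP R n A := by
  obtain ⟨k, p, hp, hkp⟩ := hC
  obtain ⟨p', hp'⟩ := Module.projective_lifting_property g p hg
  have hgp (x) : g (p' x) = p x := LinearMap.congr_fun hp' x
  have hgf (x) : g (f x) = 0 := (hfg (f x)).2 ⟨x, rfl⟩
  obtain ⟨α, hα⟩ : ∃ α : LinearMap.ker p →ₗ[R] A, ∀ x, f (α x) = -p' x.1 := by
    let e := LinearEquiv.ofInjective f hf
    refine ⟨e.symm.toLinearMap ∘ₗ
      (-(p' ∘ₗ (LinearMap.ker p).subtype)).codRestrict (LinearMap.range f) ?_, fun x => ?_⟩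
    · rintro ⟨x, hx⟩
      exact (hfg _).1 (by simpa [hgp] using hx)
    · exact congrArg Subtype.val (e.apply_symm_apply _)
  -- The pullback of `g` and `p`, identified with `A × R^k` by means of the lift `p'`.
  have hX : ModuleFP R n (A × (Fin k → R)) := by
    refine extension (A := LinearMap.ker p) (C := B)
      (LinearMap.prod α (LinearMap.ker p).subtype) (f.coprod p') ?_ ?_ ?_ hkp hB
    · intro x y h
      exact Subtype.ext (congrArg Prod.snd h)
    · rintro ⟨a, x⟩
      constructor
      · intro h
        have h0 : f a + p' x = 0 := by simpa using h
        have hx : x ∈ LinearMap.ker p := by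
          have := congrArg g h0
          rwa [map_add, hgf, zero_add, hgp, map_zero] at this
        exact ⟨⟨x, hx⟩, Prod.ext (hf ((hα _).trans (eq_neg_of_add_eq_zero_left h0).symm)) rfl⟩
      · rintro ⟨⟨y, hy⟩, h⟩
        have h1 : α ⟨y, hy⟩ = a := congrArg Prod.fst h
        have h2 : y = x := congrArg Prod.snd h
        simp [← h1, ← h2, hα]
    · intro b
      obtain ⟨x, hx⟩ := hp (g b)
      obtain ⟨a, ha⟩ := (hfg (b - p' x)).1 (by simp [hgp, hx])
      exact ⟨(a, x), by simp [ha]⟩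
  exact of_retract (LinearMap.inl R A _) (LinearMap.fst R A _) (by ext; rfl) hX

end ModuleFP

/-! ### Homomorphisms of type `FP_n` -/

/-- A homomorphism `f : A → A'` of type `FP_n`: for `n = 0` its range lies in a finitely generated
submodule, and for `n > 0` it lifts to a homomorphism from an extension `E` of `A` to a finitely
generated projective module `F` over `A'`, such that the induced homomorphism of the kernels of
`E → A` and `F → A'` is of type `FP_{n-1}`. Neither `E` is required to be projective, nor
`F → A'` to be surjective. The identity of `A` is of type `FP_n` if and only if `A` is. -/
def LinearMapFP (S : Type u) [Ring S] : ∀ (_ : ℕ) (A A' : Type u) [AddCommGroup A] [Module S A]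
    [AddCommGroup A'] [Module S A'] (_ : A →ₗ[S] A'), Prop
  | 0, _, A', _, _, _, _, f => ∃ p : Submodule S A', p.FG ∧ LinearMap.range f ≤ p
  | n + 1, A, A', _, _, _, _, f =>
    ∃ (E F : Type u) (_ : AddCommGroup E) (_ : Module S E) (_ : AddCommGroup F) (_ : Module S F)
      (π : E →ₗ[S] A) (p : F →ₗ[S] A') (t : E →ₗ[S] F) (ht : ∀ x ∈ LinearMap.ker π,
        t x ∈ LinearMap.ker p), Module.Finite S F ∧ Module.Projective S F ∧
      Function.Surjective π ∧ (∀ x, p (t x) = f (π x)) ∧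
      LinearMapFP S n (LinearMap.ker π) (LinearMap.ker p) (t.restrict ht)

namespace LinearMapFP

variable {S : Type u} [Ring S] {A B C : Type u} [AddCommGroup A] [Module S A]
  [AddCommGroup B] [Module S B] [AddCommGroup C] [Module S C]

theorem comp_left {n : ℕ} {f : A →ₗ[S] B} (hf : LinearMapFP S n A B f) (g : B →ₗ[S] C) :
    LinearMapFP S n A C (g ∘ₗ f) := by
  induction n generalizing A B C with
  | zero =>
    obtain ⟨p, hp, hfp⟩ := hf
    refine ⟨p.map g, hp.map g, ?_⟩
    rw [LinearMap.range_comp]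
    exact Submodule.map_mono hfp
  | succ n ih =>
    obtain ⟨E, F, _, _, _, _, π, p, t, ht, hF, hF', hπ, hsq, hk⟩ := hf
    have hle : LinearMap.ker p ≤ LinearMap.ker (g ∘ₗ p) := LinearMap.ker_le_ker_comp p g
    exact ⟨E, F, _, _, _, _, π, g ∘ₗ p, t, fun x hx => hle (ht x hx), hF, hF', hπ,
      fun x => congrArg g (hsq x), ih hk (Submodule.inclusion hle)⟩

theorem comp_right {n : ℕ} {f : B →ₗ[S] C} (hf : LinearMapFP S n B C f) (g : A →ₗ[S] B) :
    LinearMapFP S n A C (f ∘ₗ g) := by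
  induction n generalizing A B C with
  | zero =>
    obtain ⟨p, hp, hfp⟩ := hf
    exact ⟨p, hp, (LinearMap.range_comp_le_range g f).trans hfp⟩
  | succ n ih =>
    obtain ⟨E, F, _, _, _, _, π, p, t, ht, hF, hF', hπ, hsq, hk⟩ := hf
    -- the pullback of `π` and `g`
    let X := LinearMap.ker (π.coprod (-g))
    have hX (x : X) : π x.1.1 = g x.1.2 := add_neg_eq_zero.1 (LinearMap.mem_ker.1 x.2)
    let q : X →ₗ[S] E := LinearMap.fst S E A ∘ₗ X.subtype
    let π' : X →ₗ[S] A := LinearMap.snd S E A ∘ₗ X.subtype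
    have hq : ∀ x ∈ LinearMap.ker π', q x ∈ LinearMap.ker π := by
      intro x hx
      have hx' : x.1.2 = 0 := hx
      rw [LinearMap.mem_ker]
      exact (hX x).trans (by rw [hx', map_zero])
    refine ⟨X, F, _, _, _, _, π', p, t ∘ₗ q, fun x hx => ht _ (hq x hx), hF, hF', ?_, ?_,
      ih (A := LinearMap.ker π') hk (q.restrict hq)⟩
    · intro a
      obtain ⟨e, he⟩ := hπ (g a)
      exact ⟨⟨(e, a), LinearMap.mem_ker.2 (add_neg_eq_zero.2 he)⟩, rfl⟩
    · intro x
      exact (hsq _).trans (congrArg f (hX x))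

theorem of_subsingleton (n : ℕ) [Subsingleton A] (f : A →ₗ[S] B) : LinearMapFP S n A B f := by
  induction n generalizing A B with
  | zero =>
    refine ⟨⊥, Submodule.fg_bot, ?_⟩
    rintro _ ⟨x, rfl⟩
    rw [Subsingleton.elim x 0, map_zero]
    exact Submodule.zero_mem _
  | succ n ih =>
    refine ⟨A, PUnit, _, _, _, _, LinearMap.id, 0, 0, fun _ _ => by simp, inferInstance,
      inferInstance, Function.surjective_id, fun x => ?_, ih _⟩
    rw [Subsingleton.elim x 0]; simp

theorem id_of_projective (n : ℕ) [Module.Finite S A] [Module.Projective S A] :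
    LinearMapFP S n A A LinearMap.id := by
  cases n with
  | zero => exact ⟨⊤, Module.Finite.fg_top, le_top⟩
  | succ n =>
    refine ⟨A, A, _, _, _, _, LinearMap.id, LinearMap.id, LinearMap.id, fun _ h => h, inferInstance,
      inferInstance, Function.surjective_id, fun x => rfl, ?_⟩
    have : Subsingleton (LinearMap.ker (LinearMap.id : A →ₗ[S] A)) := by
      rw [LinearMap.ker_id]; infer_instance
    exact of_subsingleton n _

theorem zero (n : ℕ) : LinearMapFP S n A B 0 := by
  have h := (of_subsingleton (S := S) n (0 : PUnit.{u+1} →ₗ[S] B)).comp_right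
    (0 : A →ₗ[S] PUnit.{u+1})
  rwa [LinearMap.zero_comp] at h

theorem add {n : ℕ} {f g : A →ₗ[S] B} (hf : LinearMapFP S n A B f) (hg : LinearMapFP S n A B g) :
    LinearMapFP S n A B (f + g) := by
  induction n generalizing A B with
  | zero =>
    obtain ⟨p, hp, hfp⟩ := hf
    obtain ⟨q, hq, hgq⟩ := hg
    refine ⟨p ⊔ q, hp.sup hq, ?_⟩
    rintro _ ⟨x, rfl⟩
    exact Submodule.add_mem_sup (hfp ⟨x, rfl⟩) (hgq ⟨x, rfl⟩)
  | succ n ih =>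
    obtain ⟨E₁, F₁, _, _, _, _, π₁, p₁, t₁, ht₁, _, _, hπ₁, hsq₁, hk₁⟩ := hf
    obtain ⟨E₂, F₂, _, _, _, _, π₂, p₂, t₂, ht₂, _, _, hπ₂, hsq₂, hk₂⟩ := hg
    -- the pullback of `π₁` and `π₂`
    let X := LinearMap.ker (π₁.coprod (-π₂))
    have hX (x : X) : π₁ x.1.1 = π₂ x.1.2 := add_neg_eq_zero.1 (LinearMap.mem_ker.1 x.2)
    let q₁ : X →ₗ[S] E₁ := LinearMap.fst S E₁ E₂ ∘ₗ X.subtype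
    let q₂ : X →ₗ[S] E₂ := LinearMap.snd S E₁ E₂ ∘ₗ X.subtype
    let π : X →ₗ[S] A := π₁ ∘ₗ q₁
    have h₁ : ∀ x ∈ LinearMap.ker π, q₁ x ∈ LinearMap.ker π₁ := fun x hx => hx
    have h₂ : ∀ x ∈ LinearMap.ker π, q₂ x ∈ LinearMap.ker π₂ := fun x hx => (hX x).symm.trans hx
    have hi₁ : ∀ x ∈ LinearMap.ker p₁, LinearMap.inl S F₁ F₂ x ∈ LinearMap.ker (p₁.coprod p₂) := by
      intro x hx; simpa using hx
    have hi₂ : ∀ x ∈ LinearMap.ker p₂, LinearMap.inr S F₁ F₂ x ∈ LinearMap.ker (p₁.coprod p₂) := by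
      intro x hx; simpa using hx
    have hsum := ih
      ((hk₁.comp_right (A := LinearMap.ker π) (q₁.restrict h₁)).comp_left
        ((LinearMap.inl S F₁ F₂).restrict hi₁))
      ((hk₂.comp_right (A := LinearMap.ker π) (q₂.restrict h₂)).comp_left
        ((LinearMap.inr S F₁ F₂).restrict hi₂))
    refine ⟨X, F₁ × F₂, _, _, _, _, π, p₁.coprod p₂, (t₁ ∘ₗ q₁).prod (t₂ ∘ₗ q₂), ?_,
      inferInstance, inferInstance, ?_, ?_, ?_⟩
    · intro x hx
      have e₁ : p₁ (t₁ (q₁ x)) = 0 := ht₁ _ (h₁ x hx)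
      have e₂ : p₂ (t₂ (q₂ x)) = 0 := ht₂ _ (h₂ x hx)
      simp [e₁, e₂]
    · intro a
      obtain ⟨e₁, he₁⟩ := hπ₁ a
      obtain ⟨e₂, he₂⟩ := hπ₂ a
      exact ⟨⟨(e₁, e₂), LinearMap.mem_ker.2 (add_neg_eq_zero.2 (he₁.trans he₂.symm))⟩, he₁⟩
    · intro x
      have e₁ : p₁ (t₁ (q₁ x)) = f (π x) := hsq₁ _
      have e₂ : p₂ (t₂ (q₂ x)) = g (π x) := (hsq₂ _).trans (congrArg g (hX x).symm)
      simp [e₁, e₂]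
    · convert hsum using 1
      ext x
      · exact (add_zero _).symm
      · exact (zero_add _).symm

theorem sum {n : ℕ} {ι : Type*} (s : Finset ι) {f : ι → A →ₗ[S] B}
    (hf : ∀ i ∈ s, LinearMapFP S n A B (f i)) : LinearMapFP S n A B (∑ i ∈ s, f i) :=
  Finset.sum_induction f _ (fun _ _ => add) (zero n) hf

end LinearMapFP

namespace ModuleFP

variable {S : Type u} [Ring S] {A : Type u} [AddCommGroup A] [Module S A]

theorem linearMapFP_id {n : ℕ} (h : ModuleFP S n A) : LinearMapFP S n A A LinearMap.id := by
  induction n generalizing A with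
  | zero => exact ⟨⊤, h.finite.fg_top, le_top⟩
  | succ n ih =>
    obtain ⟨k, f, hf, hk⟩ := h
    exact ⟨_, _, _, _, _, _, f, f, LinearMap.id, fun _ h => h, inferInstance, inferInstance, hf,
      fun _ => rfl, ih hk⟩

theorem of_linearMapFP_id {n : ℕ} (h : LinearMapFP S n A A LinearMap.id) : ModuleFP S n A := by
  induction n generalizing A with
  | zero =>
    obtain ⟨p, hp, hle⟩ := h
    rw [LinearMap.range_id, top_le_iff] at hle
    exact ⟨hle ▸ hp⟩
  | succ n ih =>
    obtain ⟨E, F, _, _, _, _, π, p, t, ht, _, _, hπ, hsq, hk⟩ := h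
    have hsq (x) : p (t x) = π x := hsq x
    have hp : Function.Surjective p := fun a => by
      obtain ⟨e, rfl⟩ := hπ a
      exact ⟨t e, hsq e⟩
    obtain ⟨s, hs⟩ := Module.projective_lifting_property π p hπ
    have hs (x) : π (s x) = p x := LinearMap.congr_fun hs x
    have hs' : ∀ x ∈ LinearMap.ker p, s x ∈ LinearMap.ker π := fun x hx => (hs x).trans hx
    -- The identity of `ker p` is the sum of a homomorphism through `ker π` and one through `F`.
    have key : LinearMapFP S n (LinearMap.ker p) (LinearMap.ker p) LinearMap.id := by
      have h₁ := hk.comp_right (s.restrict hs')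
      let δ : F →ₗ[S] LinearMap.ker p :=
        (LinearMap.id - t ∘ₗ s).codRestrict _ fun x => by simp [hsq, hs]
      have h₂ := ((LinearMapFP.id_of_projective (S := S) (A := F) n).comp_left δ).comp_right
        (LinearMap.ker p).subtype
      convert h₁.add h₂ using 1
      ext x
      simp [δ]
    exact cokernel (LinearMap.ker p).subtype p Subtype.val_injective
      (LinearMap.exact_subtype_ker_map p) hp (ih key) (of_projective _)

/-- A finite direct sum decomposition of the identity through modules of type `FP_n`. -/
theorem of_sum_comp_eq_id {n : ℕ} {ι : Type*} [Fintype ι] {W : ι → Type u}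
    [∀ i, AddCommGroup (W i)] [∀ i, Module S (W i)] (h : ∀ i, ModuleFP S n (W i))
    (f : ∀ i, A →ₗ[S] W i) (g : ∀ i, W i →ₗ[S] A)
    (hid : ∑ i, g i ∘ₗ f i = LinearMap.id) : ModuleFP S n A := by
  refine of_linearMapFP_id ?_
  rw [← hid]
  exact LinearMapFP.sum Finset.univ fun i _ =>
    ((h i).linearMapFP_id.comp_left (g i)).comp_right (f i)

theorem pi {n : ℕ} {ι : Type} [Finite ι] {W : ι → Type u} [∀ i, AddCommGroup (W i)]
    [∀ i, Module S (W i)] (h : ∀ i, ModuleFP S n (W i)) : ModuleFP S n (∀ i, W i) := by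
  classical
  cases nonempty_fintype ι
  refine of_sum_comp_eq_id h LinearMap.proj (LinearMap.single S W) ?_
  ext i x j
  simp

end ModuleFP

/-! ### Restriction of scalars along an almost finitely generated free extension -/

section Restriction

variable {R S : Type u} [Ring R] [Ring S] [Module S R]

/-- `R` is almost finitely generated and free as an `S`-module, up to the normal regular element
`σ`: a finitely generated free `S`-module embeds into `R` with an image that contains `σR`. -/
structure IsAlmostFiniteFree (S : Type u) {R : Type u} [Ring R] [Ring S] [Module S R]
    (σ : R) : Prop where
  mul_right (r : R) : ∃ r', r * σ = σ * r'
  mul_left (r : R) : ∃ r', σ * r = r' * σ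
  left_regular : IsLeftRegular σ
  right_regular : IsRightRegular σ
  embedding : ∃ (T : Type u) (_ : Finite T) (θ : (T → S) →ₗ[S] R), Function.Injective θ ∧
    ∀ r, ∃ y, θ y = σ * r

namespace IsAlmostFiniteFree

variable {σ : R}

theorem mul_pow_right (h : IsAlmostFiniteFree S σ) (k : ℕ) (r : R) :
    ∃ r', r * σ ^ k = σ ^ k * r' := by
  induction k with
  | zero => exact ⟨r, by simp⟩
  | succ k ih =>
    obtain ⟨a, ha⟩ := ih
    obtain ⟨b, hb⟩ := h.mul_right a
    exact ⟨b, by rw [pow_succ, ← mul_assoc, ha, mul_assoc, hb, mul_assoc]⟩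

theorem mul_pow_left (h : IsAlmostFiniteFree S σ) (k : ℕ) (r : R) :
    ∃ r', σ ^ k * r = r' * σ ^ k := by
  induction k with
  | zero => exact ⟨r, by simp⟩
  | succ k ih =>
    obtain ⟨a, ha⟩ := ih
    obtain ⟨b, hb⟩ := h.mul_left a
    exact ⟨b, by rw [pow_succ', mul_assoc, ha, ← mul_assoc, hb, mul_assoc]⟩

variable [IsScalarTower S R R]

/-- The submodule `σ^k K` of an `R`-module `K`, as an `S`-module. -/
def powSMul (h : IsAlmostFiniteFree S σ) (K : Type u) [AddCommGroup K] [Module R K]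
    [Module S K] [IsScalarTower S R K] (k : ℕ) :
    Submodule S K where
  carrier := {x | ∃ y : K, x = σ ^ k • y}
  add_mem' := by
    rintro _ _ ⟨y, rfl⟩ ⟨z, rfl⟩
    exact ⟨y + z, (smul_add _ _ _).symm⟩
  zero_mem' := ⟨0, (smul_zero _).symm⟩
  smul_mem' := by
    rintro a _ ⟨y, rfl⟩
    obtain ⟨r, hr⟩ := h.mul_pow_right k (a • 1)
    exact ⟨r • y, by rw [← smul_assoc, ← mul_smul, ← hr, smul_mul_assoc, one_mul]⟩

theorem powSMul_anti (h : IsAlmostFiniteFree S σ) {K : Type u} [AddCommGroup K] [Module R K]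
    [Module S K] [IsScalarTower S R K] : Antitone (h.powSMul K) := by
  rintro k l hkl _ ⟨y, rfl⟩
  obtain ⟨d, rfl⟩ := Nat.exists_eq_add_of_le hkl
  exact ⟨σ ^ d • y, by rw [pow_add, mul_smul]⟩

theorem map_mem_powSMul (h : IsAlmostFiniteFree S σ) {K L : Type u} [AddCommGroup K] [Module R K]
    [Module S K] [IsScalarTower S R K] [AddCommGroup L] [Module R L] [Module S L]
    [IsScalarTower S R L]
    (f : K →ₗ[R] L) {k : ℕ} {x : K} (hx : x ∈ h.powSMul K k) : f x ∈ h.powSMul L k := by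
  obtain ⟨y, rfl⟩ := hx
  exact ⟨f y, map_smul _ _ _⟩

/-- A finitely generated free `S`-module between `σ^(k+1) R^d` and `σ^k R^d`. -/
theorem exists_embedding (h : IsAlmostFiniteFree S σ) (d k : ℕ) :
    ∃ (T : Type u) (_ : Finite T) (θ : (T → S) →ₗ[S] (Fin d → R)), Function.Injective θ ∧
      (∀ y, θ y ∈ h.powSMul (Fin d → R) k) ∧ ∀ x ∈ h.powSMul (Fin d → R) (k + 1), ∃ y, θ y = x := by
  obtain ⟨T, _, θ, hθ, hσ⟩ := h.embedding
  let ρ : R →ₗ[S] R :=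
    { toFun := fun r => r * σ ^ k
      map_add' := fun a b => add_mul a b _
      map_smul' := fun a b => smul_mul_assoc a b _ }
  let Θ : (Fin d × T → S) →ₗ[S] (Fin d → R) :=
    LinearMap.pi fun i => ρ ∘ₗ θ ∘ₗ LinearMap.funLeft S S (fun t => (i, t))
  have hΘ (y i) : Θ y i = θ (fun t => y (i, t)) * σ ^ k := rfl
  refine ⟨Fin d × T, inferInstance, Θ, ?_, ?_, ?_⟩
  · intro y z hyz
    ext ⟨i, t⟩
    have := congrFun hyz i
    rw [hΘ, hΘ] at this
    exact congrFun (hθ (h.right_regular.pow k this)) t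
  · intro y
    choose r hr using fun i => h.mul_pow_right k (θ fun t => y (i, t))
    exact ⟨r, funext fun i => by rw [hΘ, hr]; rfl⟩
  · rintro _ ⟨z, rfl⟩
    choose r hr using fun i => h.mul_pow_left k (z i)
    choose y hy using fun i => hσ (r i)
    refine ⟨fun p => y p.1 p.2, funext fun i => ?_⟩
    rw [hΘ, hy, mul_assoc, ← hr, ← mul_assoc, pow_succ']
    rfl

/-- If the `R`-module `K` is of type `FP_n`, then over `S` the inclusions between the terms of the
filtration `σ^k K` which skip `n` steps are of type `FP_n`. -/
theorem linearMapFP_inclusion (h : IsAlmostFiniteFree S σ) {n : ℕ} {K : Type u}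
    [AddCommGroup K] [Module R K]
    [Module S K] [IsScalarTower S R K] (hσ : ∀ x : K, σ • x = 0 → x = 0) (hK : ModuleFP R n K)
    (k : ℕ) :
    LinearMapFP S n (h.powSMul K (n + 1 + k)) (h.powSMul K k)
      (Submodule.inclusion (h.powSMul_anti (by omega))) := by
  induction n generalizing K k with
  | zero =>
    obtain ⟨d, g, hg⟩ := @Module.Finite.exists_fin' _ _ _ _ _ hK
    obtain ⟨T, _, θ, -, hθ, hσθ⟩ := h.exists_embedding d k
    let p : (T → S) →ₗ[S] h.powSMul K k := ((g.restrictScalars S) ∘ₗ θ).codRestrict _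
      fun y => h.map_mem_powSMul g (hθ y)
    refine ⟨LinearMap.range p, ?_, ?_⟩
    · rw [LinearMap.range_eq_map]; exact Module.Finite.fg_top.map p
    · rintro _ ⟨⟨_, y, rfl⟩, rfl⟩
      obtain ⟨x, rfl⟩ := hg y
      obtain ⟨z, hz⟩ := hσθ (σ ^ (k + 1) • x) ⟨x, rfl⟩
      refine ⟨z, Subtype.ext ?_⟩
      change g (θ z) = σ ^ (0 + 1 + k) • g x
      rw [hz, map_smul, zero_add, add_comm]
  | succ n ih =>
    obtain ⟨d, g, hg, hL⟩ := hK
    obtain ⟨T, _, θ, hθi, hθ, hσθ⟩ := h.exists_embedding d k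
    have hpow (j : ℕ) (x : K) (hx : σ ^ j • x = 0) : x = 0 := by
      induction j with
      | zero => simpa using hx
      | succ j ihj => exact ihj (hσ _ (by rwa [← mul_smul, ← pow_succ']))
    have hσL (x : LinearMap.ker g) (hx : σ • x = 0) : x = 0 := by
      ext i
      have : σ * x.1 i = σ * 0 := by
        rw [mul_zero]; exact congrFun (congrArg Subtype.val hx) i
      exact h.left_regular this
    have hL := ih hσL hL (k + 1)
    let e := LinearEquiv.ofInjective θ hθi
    let π : h.powSMul (Fin d → R) (n + 1 + 1 + k) →ₗ[S] h.powSMul K (n + 1 + 1 + k) :=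
      (g.restrictScalars S).restrict fun x hx => h.map_mem_powSMul g hx
    let p : (T → S) →ₗ[S] h.powSMul K k := ((g.restrictScalars S) ∘ₗ θ).codRestrict _
      fun y => h.map_mem_powSMul g (hθ y)
    obtain ⟨t, ht⟩ : ∃ t : h.powSMul (Fin d → R) (k + 1) →ₗ[S] (T → S), ∀ x, θ (t x) = x.1 :=
      ⟨e.symm.toLinearMap ∘ₗ Submodule.inclusion fun x hx => hσθ x hx,
        fun x => congrArg Subtype.val (e.apply_symm_apply _)⟩
    let i : h.powSMul (Fin d → R) (n + 1 + 1 + k) →ₗ[S] h.powSMul (Fin d → R) (k + 1) :=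
      Submodule.inclusion (h.powSMul_anti (by omega))
    have hker : ∀ x ∈ LinearMap.ker π, (t ∘ₗ i) x ∈ LinearMap.ker p := fun x hx => by
      refine Subtype.ext ?_
      change g (θ (t (i x))) = 0
      rw [ht]
      exact congrArg Subtype.val hx
    refine ⟨_, T → S, _, _, _, _, π, p, t ∘ₗ i, hker, inferInstance, inferInstance, ?_, ?_, ?_⟩
    · rintro ⟨_, y, rfl⟩
      obtain ⟨x, rfl⟩ := hg y
      exact ⟨⟨σ ^ (n + 1 + 1 + k) • x, x, rfl⟩, Subtype.ext (map_smul g _ _)⟩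
    · intro x
      refine Subtype.ext ?_
      change g (θ (t (i x))) = g x.1
      rw [ht]
      rfl
    · -- The homomorphism of kernels passes through `σ^(n+2+k) L → σ^(k+1) L`, `L = ker g`.
      let a : LinearMap.ker π →ₗ[S] h.powSMul (LinearMap.ker g) (n + 1 + (k + 1)) :=
        { toFun := fun x => ⟨⟨x.1.1, congrArg Subtype.val x.2⟩, by
            obtain ⟨⟨_, y, rfl⟩, hy⟩ := x
            have hy' : g (σ ^ (n + 1 + 1 + k) • y) = 0 := congrArg Subtype.val hy
            rw [map_smul] at hy'
            exact ⟨⟨y, hpow _ _ hy'⟩, Subtype.ext (by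
              rw [show n + 1 + (k + 1) = n + 1 + 1 + k by omega]; rfl)⟩⟩
          map_add' := fun _ _ => rfl
          map_smul' := fun _ _ => rfl }
      let b : h.powSMul (LinearMap.ker g) (k + 1) →ₗ[S] LinearMap.ker p :=
        (t ∘ₗ ((LinearMap.ker g).subtype.restrictScalars S).restrict
          fun x hx => h.map_mem_powSMul (LinearMap.ker g).subtype hx).codRestrict _ fun x => by
            refine Subtype.ext ?_
            change g (θ (t _)) = 0
            rw [ht]
            exact x.1.2
      exact (hL.comp_right (A := LinearMap.ker π) a).comp_left b

/-- An `R`-module of type `FP_n` on which `σ` acts as the identity is of type `FP_n` over `S`. -/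
theorem moduleFP_restrictScalars (h : IsAlmostFiniteFree S σ) {n : ℕ} {K : Type u}
    [AddCommGroup K] [Module R K]
    [Module S K] [IsScalarTower S R K] (hσ : ∀ x : K, σ • x = x) (hK : ModuleFP R n K) :
    ModuleFP S n K := by
  have hpow (k : ℕ) (x : K) : σ ^ k • x = x := by
    induction k with
    | zero => simp
    | succ k ih => rw [pow_succ, mul_smul, hσ, ih]
  have key := h.linearMapFP_inclusion (fun x hx => by rwa [hσ] at hx) hK 0
  refine ModuleFP.of_linearMapFP_id ?_
  exact (key.comp_left (Submodule.subtype _)).comp_right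
    (LinearMap.id.codRestrict (h.powSMul K (n + 1 + 0)) fun x => ⟨x, (hpow _ _).symm⟩)

end IsAlmostFiniteFree

end Restriction

/-! ### Induction of modules along an inclusion of monoids -/

section Induction

open MonoidAlgebra (single mapDomainRingHom)

theorem MonoidAlgebra.single_mul_mapDomainRingHom {N N₁ : Type u} [Monoid N] [Monoid N₁]
    (ι : N₁ →* N) (t : N) (y : MonoidAlgebra ℤ N₁) : single t (1 : ℤ) * mapDomainRingHom ℤ ι y =
      ofCoeff (Finsupp.mapDomain (fun s => t * ι s) y.coeff) := by
  induction y using MonoidAlgebra.induction_linear with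
  | zero => simp
  | add a b ha hb =>
    rw [map_add, mul_add, ha, hb, coeff_add, Finsupp.mapDomain_add, ofCoeff_add]
  | single n c => simp [single_mul_single, Finsupp.mapDomain_single]

variable {N N₁ : Type u} [Monoid N] [Monoid N₁] (ι : N₁ →* N) {Q : Type u} (q : N → Q)
  {V W : Type u} [AddCommGroup V] [Module (MonoidAlgebra ℤ N₁) V]
  [AddCommGroup W] [Module (MonoidAlgebra ℤ N) W]

/-- The sum `∑ a, T a • j (v a)` over `a : Q`. -/
noncomputable def inducedSum (j : V →ₛₗ[mapDomainRingHom ℤ ι] W) (T : Q → N) : (Q →₀ V) →+ W :=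
  Finsupp.liftAddHom fun a =>
    (DistribSMul.toAddMonoidHom W (single (T a) (1 : ℤ))).comp j.toAddMonoidHom

variable {ι}

theorem inducedSum_single (j : V →ₛₗ[mapDomainRingHom ℤ ι] W) (T : Q → N) (a : Q) (x : V) :
    inducedSum ι j T (Finsupp.single a x) = single (T a) (1 : ℤ) • j x :=
  Finsupp.liftAddHom_apply_single _ _ _

theorem inducedSum_apply (j : V →ₛₗ[mapDomainRingHom ℤ ι] W) (T : Q → N) (v : Q →₀ V) :
    inducedSum ι j T v = v.sum fun a x => single (T a) (1 : ℤ) • j x := rfl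

theorem inducedSum_congr (j : V →ₛₗ[mapDomainRingHom ℤ ι] W) {T T' : Q → N} {v : Q →₀ V}
    (h : ∀ a ∈ v.support, T a = T' a) : inducedSum ι j T v = inducedSum ι j T' v := by
  rw [inducedSum_apply, inducedSum_apply]
  exact Finsupp.sum_congr fun a ha => by rw [h a ha]

variable (ι) in
/-- `q : N → Q` is the projection to the cosets `tN₁` of a submonoid `ι : N₁ → N`, any two elements
of a coset being comparable: one of them is a right multiple of the other by an element of `N₁`. -/
def IsCosetProjection : Prop :=
  ∀ t t', q t = q t' ↔ ∃ h, t' = t * ι h ∨ t = t' * ι h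

/-- The `ℤN`-module `W` is induced from the `ℤN₁`-module `V` by means of `j : V → W`: every element
of `W` is a sum `∑ a, T a • j (v a)` with `T a` in the coset `a`, and it vanishes only for `v = 0`.
(The second property forces `N₁` to act on `V` by injective maps.) -/
structure IsInducedModule (j : V →ₛₗ[mapDomainRingHom ℤ ι] W) : Prop where
  exists_eq (w : W) : ∃ (T : Q → N) (v : Q →₀ V), (∀ a ∈ v.support, q (T a) = a) ∧
    inducedSum ι j T v = w
  eq_zero (T : Q → N) (v : Q →₀ V) (hT : ∀ a ∈ v.support, q (T a) = a)
    (h : inducedSum ι j T v = 0) : v = 0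

variable {q}

/-- The coset normal form exists as soon as `W` is generated by the translates of `j(V)`. -/
theorem IsCosetProjection.exists_eq_inducedSum (hq : IsCosetProjection ι q)
    (j : V →ₛₗ[mapDomainRingHom ℤ ι] W)
    (h : AddSubmonoid.closure {w | ∃ (t : N) (x : V), w = single t (1 : ℤ) • j x} = ⊤) (w : W) :
    ∃ (T : Q → N) (v : Q →₀ V), (∀ a ∈ v.support, q (T a) = a) ∧ inducedSum ι j T v = w := by
  classical
  have hw : w ∈ AddSubmonoid.closure {w | ∃ (t : N) (x : V), w = single t (1 : ℤ) • j x} := by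
    rw [h]; trivial
  have hmul (t : N) (s : N₁) (x : V) :
      single (t * ι s) (1 : ℤ) • j x = single t (1 : ℤ) • j (single s (1 : ℤ) • x) := by
    rw [LinearMap.map_smulₛₗ, smul_smul]
    simp [MonoidAlgebra.single_mul_single]
  have hsupp {v : Q →₀ V} {a : Q} {y : V} {b : Q} (hb : b ∈ (v + Finsupp.single a y).support)
      (hba : b ≠ a) : b ∈ v.support := by
    simpa [Finsupp.single_apply, hba.symm] using hb
  induction hw using AddSubmonoid.closure_induction_right with
  | zero => exact ⟨fun _ => 1, 0, by simp, map_zero _⟩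
  | add_right w _ w' hw' ih =>
    obtain ⟨T, v, hT, rfl⟩ := ih
    obtain ⟨t, x, rfl⟩ := hw'
    -- Either the new term is absorbed by the term of `v` in the same coset, or the latter (possibly
    -- zero) by the new term.
    by_cases hcase : q t ∈ v.support ∧ ∃ s, t = T (q t) * ι s
    · obtain ⟨hv, s, hs⟩ := hcase
      refine ⟨T, v + Finsupp.single (q t) (single s (1 : ℤ) • x), ?_, ?_⟩
      · intro b hb
        by_cases hba : b = q t
        · subst hba; exact hT _ hv
        · exact hT b (hsupp hb hba)
      · rw [map_add, inducedSum_single, ← hmul, ← hs]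
    · obtain ⟨y, hy⟩ : ∃ y : V, single t (1 : ℤ) • j y =
          inducedSum ι j T (Finsupp.single (q t) (v (q t))) := by
        by_cases hv : q t ∈ v.support
        · obtain ⟨s, hs | hs⟩ := (hq t (T (q t))).1 (hT _ hv).symm
          · exact ⟨single s (1 : ℤ) • v (q t), by rw [inducedSum_single, ← hmul, ← hs]⟩
          · exact absurd ⟨hv, s, hs⟩ hcase
        · exact ⟨0, by simp [Finsupp.notMem_support_iff.1 hv]⟩
      refine ⟨Function.update T (q t) t, v.erase (q t) + Finsupp.single (q t) (y + x), ?_, ?_⟩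
      · intro b hb
        by_cases hba : b = q t
        · subst hba; simp
        · rw [Function.update_of_ne hba]
          have := hsupp hb hba
          rw [Finsupp.support_erase] at this
          exact hT b (Finset.mem_of_mem_erase this)
      · rw [map_add, inducedSum_single, Function.update_self, map_add, smul_add, hy, ← add_assoc]
        congr 1
        rw [inducedSum_congr (T' := T), ← map_add, Finsupp.erase_add_single]
        intro b hb
        rw [Finsupp.support_erase] at hb
        exact Function.update_of_ne (Finset.ne_of_mem_erase hb) _ _

theorem IsInducedModule.closure_eq_top {j : V →ₛₗ[mapDomainRingHom ℤ ι] W}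
    (h : IsInducedModule q j) :
    AddSubmonoid.closure {w | ∃ (t : N) (x : V), w = single t (1 : ℤ) • j x} = ⊤ := by
  refine top_unique fun w _ => ?_
  obtain ⟨T, v, -, rfl⟩ := h.exists_eq w
  exact sum_mem fun a _ => AddSubmonoid.subset_closure ⟨_, _, rfl⟩

variable (ι) in
/-- The coordinatewise inclusion `ℤN₁^k → ℤN^k`. -/
noncomputable def inducedPi (k : ℕ) :
    (Fin k → MonoidAlgebra ℤ N₁) →ₛₗ[mapDomainRingHom ℤ ι] (Fin k → MonoidAlgebra ℤ N) where
  toFun y i := mapDomainRingHom ℤ ι (y i)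
  map_add' _ _ := funext fun _ => map_add _ _ _
  map_smul' _ _ := funext fun _ => map_mul _ _ _

theorem isInducedModule_pi [IsLeftCancelMul N] (hq : IsCosetProjection ι q)
    (hι : Function.Injective ι) (k : ℕ) : IsInducedModule q (inducedPi ι k) where
  exists_eq := by
    refine hq.exists_eq_inducedSum _ (top_unique fun y _ => ?_)
    rw [← Finset.univ_sum_single y]
    refine sum_mem fun i _ => ?_
    induction y i using MonoidAlgebra.induction_linear with
    | zero => rw [Pi.single_zero]; exact zero_mem _
    | add a b ha hb => rw [Pi.single_add]; exact add_mem ha hb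
    | single n c =>
      refine AddSubmonoid.subset_closure ⟨n, Pi.single i (single 1 c), ?_⟩
      ext1 l
      by_cases hl : l = i
      · subst hl
        simp [inducedPi, MonoidAlgebra.single_mul_single]
      · simp [inducedPi, hl]
  eq_zero T v hT h := by
    ext b i s
    by_cases hb : b ∈ v.support
    swap
    · simp [Finsupp.notMem_support_iff.1 hb]
    have hinj : Function.Injective fun s => T b * ι s := fun s s' hs => hι (mul_left_cancel hs)
    have h1 : (inducedSum ι (inducedPi ι k) T v i).coeff (T b * ι s) = 0 := by rw [h]; rfl
    rw [inducedSum_apply, Finsupp.sum, Finset.sum_apply, MonoidAlgebra.coeff_sum,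
      Finsupp.finsetSum_apply, Finset.sum_eq_single b] at h1
    · change (single (T b) (1 : ℤ) * mapDomainRingHom ℤ ι (v b i)).coeff (T b * ι s) = 0 at h1
      rw [MonoidAlgebra.single_mul_mapDomainRingHom] at h1
      exact (Finsupp.mapDomain_apply hinj _ s).symm.trans h1
    · intro a ha hab
      change (single (T a) (1 : ℤ) * mapDomainRingHom ℤ ι (v a i)).coeff (T b * ι s) = 0
      rw [MonoidAlgebra.single_mul_mapDomainRingHom]
      refine Finsupp.mapDomain_of_notMem_range _ _ ?_
      rintro ⟨s', hs'⟩
      refine hab ?_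
      rw [← hT a ha, ← hT b hb, (hq _ _).2 ⟨s', Or.inl rfl⟩, (hq (T b) _).2 ⟨s, Or.inl rfl⟩]
      exact congrArg q hs'
    · exact fun hb' => absurd hb hb'

/-- A presentation of `V` extends to a presentation of the induced module. -/
theorem IsInducedModule.exists_surjective {j : V →ₛₗ[mapDomainRingHom ℤ ι] W}
    (h : IsInducedModule q j) {k : ℕ}
    (f : (Fin k → MonoidAlgebra ℤ N₁) →ₗ[MonoidAlgebra ℤ N₁] V) (hf : Function.Surjective f) :
    ∃ g : (Fin k → MonoidAlgebra ℤ N) →ₗ[MonoidAlgebra ℤ N] W, Function.Surjective g ∧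
      ∀ y, g (inducedPi ι k y) = j (f y) := by
  let g := Fintype.linearCombination (MonoidAlgebra ℤ N) fun i : Fin k => j (f (Pi.single i 1))
  have hg (y) : g (inducedPi ι k y) = j (f y) := by
    conv_rhs => rw [← Finset.univ_sum_single y, map_sum, map_sum]
    refine (Fintype.linearCombination_apply _ _ _).trans (Finset.sum_congr rfl fun i _ => ?_)
    have : Pi.single i (y i) = y i • (Pi.single i 1 : Fin k → MonoidAlgebra ℤ N₁) := by
      rw [← Pi.single_smul, smul_eq_mul, mul_one]
    rw [this, map_smul, LinearMap.map_smulₛₗ]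
    rfl
  refine ⟨g, ?_, hg⟩
  rw [← LinearMap.range_eq_top, ← Submodule.toAddSubmonoid_inj, Submodule.top_toAddSubmonoid,
    ← top_le_iff, ← h.closure_eq_top, AddSubmonoid.closure_le]
  rintro _ ⟨t, x, rfl⟩
  obtain ⟨y, rfl⟩ := hf x
  exact ⟨single t (1 : ℤ) • inducedPi ι k y, by rw [map_smul, hg]⟩

/-- A module induced from a module of type `FP_n` is of type `FP_n`: a resolution by free modules
can be induced. -/
theorem IsInducedModule.moduleFP [IsLeftCancelMul N] (hq : IsCosetProjection ι q)
    (hι : Function.Injective ι) {j : V →ₛₗ[mapDomainRingHom ℤ ι] W} (h : IsInducedModule q j)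
    {n : ℕ} (hV : ModuleFP (MonoidAlgebra ℤ N₁) n V) : ModuleFP (MonoidAlgebra ℤ N) n W := by
  induction n generalizing V W with
  | zero =>
    obtain ⟨k, f, hf⟩ := @Module.Finite.exists_fin' _ _ _ _ _ hV
    obtain ⟨g, hg, -⟩ := h.exists_surjective f hf
    exact Module.Finite.of_surjective g hg
  | succ n ih =>
    classical
    obtain ⟨k, f, hf, hU⟩ := hV
    obtain ⟨g, hg, hgf⟩ := h.exists_surjective f hf
    refine ⟨k, g, hg, ?_⟩
    have hP := isInducedModule_pi hq hι k
    let J : LinearMap.ker f →ₛₗ[mapDomainRingHom ℤ ι] LinearMap.ker g :=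
      ((inducedPi ι k).comp (LinearMap.ker f).subtype).codRestrict (LinearMap.ker g) fun y => by
        rw [LinearMap.mem_ker]
        exact (hgf _).trans (by rw [Submodule.subtype_apply, y.2, map_zero])
    refine ih (V := LinearMap.ker f) (j := J) ?_ hU
    have hsum (T : Q → N) (v : Q →₀ LinearMap.ker f) : (inducedSum ι J T v : Fin k → _) =
        inducedSum ι (inducedPi ι k) T (v.mapRange (fun y => y.1) rfl) := by
      induction v using Finsupp.induction_linear with
      | zero => simp
      | add a b ha hb =>
        rw [Finsupp.mapRange_add (fun _ _ => rfl), map_add, map_add, ← ha, ← hb]; rfl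
      | single a y => rw [Finsupp.mapRange_single, inducedSum_single, inducedSum_single]; rfl
    constructor
    · rintro ⟨w, hw⟩
      obtain ⟨T, v, hT, rfl⟩ := hP.exists_eq w
      have hgs (v : Q →₀ _) : g (inducedSum ι (inducedPi ι k) T v) =
          inducedSum ι j T (v.mapRange f (map_zero f)) := by
        induction v using Finsupp.induction_linear with
        | zero => simp
        | add a b ha hb =>
          rw [Finsupp.mapRange_add (map_add f), map_add, map_add, map_add, ← ha, ← hb]
        | single a y =>
          rw [Finsupp.mapRange_single, inducedSum_single, inducedSum_single, map_smul, hgf]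
      have hv : v.mapRange f (map_zero f) = 0 := by
        refine h.eq_zero T _ (fun a ha => hT a (Finsupp.support_mapRange ha)) ?_
        rw [← hgs]
        exact hw
      refine ⟨T, v.mapRange (fun y => if hy : y ∈ LinearMap.ker f then ⟨y, hy⟩ else 0) ?_, ?_, ?_⟩
      · simp
      · exact fun a ha => hT a (Finsupp.support_mapRange ha)
      · ext1
        rw [hsum]
        congr 1
        ext1 a
        have : v a ∈ LinearMap.ker f := DFunLike.congr_fun hv a
        simp [LinearMap.mem_ker.1 this]
    · intro T v hT h0
      have := hP.eq_zero T (v.mapRange (fun y => y.1) rfl)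
        (fun a ha => hT a (Finsupp.support_mapRange ha)) (by rw [← hsum, h0]; rfl)
      ext1 a
      exact Subtype.ext (DFunLike.congr_fun this a)

end Induction

/-! ### Permutation modules -/

section Permutation

open MonoidAlgebra (single mapDomainRingHom)

/-- An additive map that commutes with the action of the monoid elements is linear over the monoid
algebra. -/
def MonoidAlgebra.linearMapOfAddMonoidHom {N : Type u} [Monoid N] {V W : Type u}
    [AddCommGroup V] [Module (MonoidAlgebra ℤ N) V] [AddCommGroup W] [Module (MonoidAlgebra ℤ N) W]
    (f : V →+ W) (h : ∀ (n : N) (x : V), f (single n (1 : ℤ) • x) = single n (1 : ℤ) • f x) :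
    V →ₗ[MonoidAlgebra ℤ N] W where
  __ := f
  map_smul' a x := by
    change f (a • x) = a • f x
    induction a using MonoidAlgebra.induction_linear with
    | zero => simp
    | add a b ha hb => simp [add_smul, ha, hb]
    | single n c =>
      have : (single n c : MonoidAlgebra ℤ N) = c • single n (1 : ℤ) := by simp
      rw [this, smul_assoc, map_zsmul, h, smul_assoc]

/-- The semilinear analogue of `MonoidAlgebra.linearMapOfAddMonoidHom`. -/
def MonoidAlgebra.semilinearMapOfAddMonoidHom {N N₁ : Type u} [Monoid N] [Monoid N₁] (ι : N₁ →* N)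
    {V W : Type u} [AddCommGroup V] [Module (MonoidAlgebra ℤ N₁) V]
    [AddCommGroup W] [Module (MonoidAlgebra ℤ N) W]
    (f : V →+ W) (h : ∀ (n : N₁) (x : V), f (single n (1 : ℤ) • x) = single (ι n) (1 : ℤ) • f x) :
    V →ₛₗ[mapDomainRingHom ℤ ι] W where
  __ := f
  map_smul' a x := by
    change f (a • x) = mapDomainRingHom ℤ ι a • f x
    induction a using MonoidAlgebra.induction_linear with
    | zero => rw [zero_smul, map_zero, map_zero, zero_smul]
    | add a b ha hb => rw [add_smul, map_add, map_add, ha, hb, add_smul]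
    | single n c =>
      have : (single n c : MonoidAlgebra ℤ N₁) = c • single n (1 : ℤ) := by simp
      rw [this, smul_assoc, map_zsmul, h, map_zsmul, smul_assoc]
      simp

/-- The underlying group of the trivial module. -/
def trivialModuleEquiv (N : Type u) [Monoid N] : trivialModule N ≃+ ℤ :=
  (Representation.asModuleEquiv (Representation.trivial ℤ N (ULift.{u} ℤ))).toAddEquiv.trans
    AddEquiv.ulift

theorem trivialModule_smul {N : Type u} [Monoid N] (n : N) (x : trivialModule N) :
    single n (1 : ℤ) • x = x :=
  (Representation.single_smul (Representation.trivial ℤ N (ULift.{u} ℤ)) 1 n x).trans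
    (one_smul ℤ _)

variable (N X : Type u) [Monoid N] [MulAction N X]

/-- The permutation representation of the monoid `N` on the free abelian group on `X`. -/
noncomputable def permRepresentation : Representation ℤ N (X →₀ ℤ) where
  toFun n := Finsupp.lmapDomain ℤ ℤ (n • ·)
  map_one' := by ext; simp
  map_mul' a b := by ext; simp [mul_smul]

/-- The permutation module `ℤX` over `ℤN`. -/
abbrev PermModule : Type u := (permRepresentation N X).asModule

variable {X}

/-- The underlying group of the permutation module. -/
noncomputable def PermModule.toFinsupp : PermModule N X ≃+ (X →₀ ℤ) :=
  (permRepresentation N X).asModuleEquiv.toAddEquiv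

/-- The element `x` of the basis `X` of `ℤX`. -/
noncomputable def PermModule.basis (x : X) : PermModule N X :=
  (toFinsupp N).symm (Finsupp.single x (1 : ℤ))

variable {N}

theorem PermModule.smul_basis (n : N) (x : X) :
    single n (1 : ℤ) • basis N x = basis N (n • x) := by
  refine (Representation.single_smul (permRepresentation N X) 1 n (basis N x)).trans ?_
  rw [one_smul]
  exact Finsupp.mapDomain_single

theorem PermModule.induction {p : PermModule N X → Prop} (h : ∀ x, p (basis N x)) (h0 : p 0)
    (hadd : ∀ a b, p a → p b → p (a + b)) (hneg : ∀ a, p a → p (-a))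
    (w : PermModule N X) : p w := by
  refine Finsupp.induction_linear (motive := fun w : X →₀ ℤ => p w) w h0 hadd fun x c => ?_
  have hx : (Finsupp.single x c : X →₀ ℤ) = c • Finsupp.single x 1 := by simp
  rw [hx]
  induction c using Int.induction_on with
  | zero => rw [zero_smul]; exact h0
  | succ i hi => rw [add_smul, one_smul]; exact hadd _ _ (by simpa using hi) (h x)
  | pred i hi =>
    rw [sub_smul, one_smul, sub_eq_add_neg]; exact hadd _ _ (by simpa using hi) (hneg _ (h x))

theorem PermModule.hom_ext {W : Type*} [AddCommGroup W] {f g : PermModule N X →+ W}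
    (h : ∀ x, f (basis N x) = g (basis N x)) : f = g := by
  ext w
  induction w using PermModule.induction with
  | h x => exact h x
  | h0 => simp
  | hadd a b ha hb => simp [ha, hb]
  | hneg a ha => simp [ha]

/-- The homomorphism out of `ℤX` given by an equivariant map out of `X`. -/
noncomputable def PermModule.lift {W : Type u} [AddCommGroup W] [Module (MonoidAlgebra ℤ N) W]
    (φ : X → W) (h : ∀ (n : N) (x : X), φ (n • x) = single n (1 : ℤ) • φ x) :
    PermModule N X →ₗ[MonoidAlgebra ℤ N] W :=
  MonoidAlgebra.linearMapOfAddMonoidHom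
    ((Finsupp.liftAddHom fun x => zmultiplesHom W (φ x)).comp (toFinsupp N).toAddMonoidHom)
    fun n w => by
    have hb (x : X) : ((Finsupp.liftAddHom fun x => zmultiplesHom W (φ x)).comp
        (toFinsupp N).toAddMonoidHom) (basis N x) = φ x :=
      (Finsupp.liftAddHom_apply_single _ _ _).trans (one_smul ℤ _)
    induction w using PermModule.induction with
    | h x => rw [smul_basis, hb, hb, h]
    | h0 => rw [smul_zero, map_zero, smul_zero]
    | hadd a b ha hb => rw [smul_add, map_add, ha, hb, map_add, smul_add]
    | hneg a ha => rw [smul_neg, map_neg, ha, map_neg, smul_neg]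

theorem PermModule.lift_basis {W : Type u} [AddCommGroup W] [Module (MonoidAlgebra ℤ N) W]
    (φ : X → W) (h : ∀ (n : N) (x : X), φ (n • x) = single n (1 : ℤ) • φ x) (x : X) :
    lift φ h (basis N x) = φ x :=
  (Finsupp.liftAddHom_apply_single (fun x => zmultiplesHom W (φ x)) x 1).trans (one_smul ℤ _)

theorem PermModule.linearMap_ext {W : Type u} [AddCommGroup W] [Module (MonoidAlgebra ℤ N) W]
    {f g : PermModule N X →ₗ[MonoidAlgebra ℤ N] W} (h : ∀ x, f (basis N x) = g (basis N x)) :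
    f = g :=
  LinearMap.toAddMonoidHom_injective (PermModule.hom_ext h)

/-- The permutation module of a transitive set is induced from the stabilizer of a point. -/
theorem PermModule.moduleFP_of_transitive [IsLeftCancelMul N] {N₁ : Type u} [Monoid N₁]
    (ι : N₁ →* N) (hι : Function.Injective ι) (x₀ : X) (hx₀ : ∀ x, ∃ n : N, n • x₀ = x)
    (hstab : ∀ t t' : N, t • x₀ = t' • x₀ ↔ ∃ h, t' = t * ι h ∨ t = t' * ι h) {n : ℕ}
    (h : ModuleFP (MonoidAlgebra ℤ N₁) n (trivialModule N₁)) :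
    ModuleFP (MonoidAlgebra ℤ N) n (PermModule N X) := by
  classical
  let q : N → X := fun t => t • x₀
  have hstab₁ (s : N₁) : ι s • x₀ = x₀ := by
    have := (hstab 1 (ι s)).2 ⟨s, Or.inl (one_mul _).symm⟩
    rwa [one_smul, eq_comm] at this
  let j : trivialModule N₁ →ₛₗ[mapDomainRingHom ℤ ι] PermModule N X :=
    MonoidAlgebra.semilinearMapOfAddMonoidHom ι
      ((zmultiplesHom _ (basis N x₀)).comp (trivialModuleEquiv N₁).toAddMonoidHom) fun s c => by
      rw [trivialModule_smul]
      change trivialModuleEquiv N₁ c • basis N x₀ =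
        single (ι s) (1 : ℤ) • trivialModuleEquiv N₁ c • basis N x₀
      rw [smul_comm, smul_basis, hstab₁]
  have hj (c : trivialModule N₁) : j c = trivialModuleEquiv N₁ c • basis N x₀ := rfl
  have hsmul (t : N) (c : trivialModule N₁) : (toFinsupp N) (single t (1 : ℤ) • j c) =
      Finsupp.single (t • x₀) (trivialModuleEquiv N₁ c) := by
    rw [hj, smul_comm, smul_basis, map_zsmul, basis, AddEquiv.apply_symm_apply]
    exact Finsupp.smul_single_one _ _
  refine IsInducedModule.moduleFP (q := q) (j := j) hstab hι ?_ h
  have hsum (T : X → N) (v : X →₀ trivialModule N₁) (hT : ∀ a ∈ v.support, q (T a) = a) :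
      toFinsupp N (inducedSum ι j T v) = v.mapRange (trivialModuleEquiv N₁) (map_zero _) := by
    rw [inducedSum_apply, map_finsuppSum]
    simp only [hsmul]
    rw [Finsupp.sum, Finset.sum_congr rfl fun a ha => by rw [show T a • x₀ = a from hT a ha]]
    ext b
    rw [Finsupp.finsetSum_apply,
      Finset.sum_eq_single b (fun a _ hab => Finsupp.single_eq_of_ne' hab)
      fun hb => by rw [Finsupp.notMem_support_iff.1 hb, map_zero, Finsupp.single_zero]; rfl]
    simp
  constructor
  · intro w
    choose T hT using hx₀
    refine ⟨T, (toFinsupp N w).mapRange (trivialModuleEquiv N₁).symm (map_zero _),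
      fun a _ => hT a, (toFinsupp N).injective ?_⟩
    rw [hsum _ _ fun a _ => hT a]
    ext a
    simp
  · intro T v hT h0
    have := hsum T v hT
    rw [h0, map_zero] at this
    ext1 a
    exact (trivialModuleEquiv N₁).injective (by
      simpa using (DFunLike.congr_fun this a).symm)

/-- A finitely generated module over a Noetherian ring is of type `FP_n`. -/
theorem ModuleFP.of_isNoetherianRing {R : Type u} [Ring R] [IsNoetherianRing R] {A : Type u}
    [AddCommGroup A] [Module R A] [Module.Finite R A] (n : ℕ) : ModuleFP R n A := by
  induction n generalizing A with
  | zero => exact inferInstanceAs (Module.Finite R A)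
  | succ n ih =>
    obtain ⟨k, f, hf⟩ := Module.Finite.exists_fin' R A
    exact ⟨k, f, hf, ih⟩

theorem isNoetherianRing_monoidAlgebra (F : Type u) [Monoid F] [Finite F] :
    IsNoetherianRing (MonoidAlgebra ℤ F) := by
  have : Module.Finite ℤ (MonoidAlgebra ℤ F) :=
    Module.Finite.equiv (MonoidAlgebra.coeffLinearEquiv ℤ (S := ℤ) (M := F)).symm
  exact isNoetherian_of_tower ℤ inferInstance

theorem finite_trivialModule (N : Type u) [Monoid N] :
    Module.Finite (MonoidAlgebra ℤ N) (trivialModule N) := by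
  refine ⟨⟨{(trivialModuleEquiv N).symm 1}, top_unique fun x _ => ?_⟩⟩
  have : x = trivialModuleEquiv N x • (trivialModuleEquiv N).symm 1 :=
    (trivialModuleEquiv N).injective (by simp)
  rw [this]
  exact zsmul_mem (Submodule.subset_span (by simp)) _

/-- A permutation module with finitely many orbits and finite stabilizers is of type `FP_n` for all
`n`. The orbits are the fibres of an invariant map `c`. -/
theorem PermModule.moduleFP_of_finite_stabilizers [IsLeftCancelMul N] {C : Type*} [Finite C]
    (c : X → C) (hc : ∀ (n : N) x, c (n • x) = c x)
    (h : ∀ x, ∃ x₀, c x₀ = c x ∧ (∀ y, c y = c x → ∃ n : N, n • x₀ = y) ∧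
      ∃ F : Submonoid N, Finite F ∧ ∀ t t' : N, t • x₀ = t' • x₀ ↔
        ∃ h : F, t' = t * h ∨ t = t' * h) (n : ℕ) :
    ModuleFP (MonoidAlgebra ℤ N) n (PermModule N X) := by
  classical
  let Y (γ : C) : SubMulAction N X := ⟨{x | c x = γ}, fun n x hx => (hc n x).trans hx⟩
  have hY (γ : C) : ModuleFP (MonoidAlgebra ℤ N) n (PermModule N (Y γ)) := by
    by_cases hγ : ∃ x, c x = γ
    · obtain ⟨x, rfl⟩ := hγ
      obtain ⟨x₀, hx₀, htrans, F, hF, hstab⟩ := h x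
      have := isNoetherianRing_monoidAlgebra F
      have := finite_trivialModule F
      refine moduleFP_of_transitive F.subtype Subtype.val_injective (⟨x₀, hx₀⟩ : Y (c x)) ?_ ?_
        (ModuleFP.of_isNoetherianRing n)
      · rintro ⟨y, hy⟩
        obtain ⟨n, hn⟩ := htrans y hy
        exact ⟨n, Subtype.ext hn⟩
      · intro t t'
        rw [← Subtype.coe_inj]
        exact hstab t t'
    · have : IsEmpty (Y γ) := ⟨fun y => hγ ⟨y.1, y.2⟩⟩
      have : Subsingleton (PermModule N (Y γ)) := (toFinsupp N).toEquiv.subsingleton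
      exact ModuleFP.of_subsingleton n
  cases nonempty_fintype C
  let g (γ : C) : PermModule N (Y γ) →ₗ[MonoidAlgebra ℤ N] PermModule N X :=
    lift (fun y : Y γ => basis N y.1) fun n y => (smul_basis n y.1).symm
  let f (γ : C) : PermModule N X →ₗ[MonoidAlgebra ℤ N] PermModule N (Y γ) :=
    lift (fun x => if hx : c x = γ then basis N (⟨x, hx⟩ : Y γ) else 0) fun n x => by
      by_cases hx : c x = γ
      · rw [dif_pos hx, dif_pos ((hc n x).trans hx), smul_basis]; rfl
      · rw [dif_neg hx, dif_neg fun h => hx ((hc n x).symm.trans h), smul_zero]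
  refine ModuleFP.of_sum_comp_eq_id hY f g (linearMap_ext fun x => ?_)
  rw [LinearMap.sum_apply, LinearMap.id_apply, Finset.sum_eq_single (c x)]
  · rw [LinearMap.comp_apply, lift_basis, dif_pos rfl, lift_basis]
  · intro γ _ hγ
    rw [LinearMap.comp_apply, lift_basis, dif_neg hγ.symm, map_zero]
  · exact fun h => absurd (Finset.mem_univ _) h

/-- If a Noetherian ring `T` is of type `FP_n` as an `R`-module, then so are the finitely generated
`T`-modules. -/
theorem ModuleFP.of_finite_of_isScalarTower {R T : Type u} [Ring R] [Ring T] [IsNoetherianRing T]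
    [Module R T] [IsScalarTower R T T] {n : ℕ} (hT : ModuleFP R n T) (A : Type u) [AddCommGroup A]
    [Module T A] [Module R A] [IsScalarTower R T A] [Module.Finite T A] : ModuleFP R n A := by
  induction n generalizing A with
  | zero =>
    have : Module.Finite R T := hT
    exact Module.Finite.trans T A
  | succ n ih =>
    obtain ⟨k, f, hf⟩ := Module.Finite.exists_fin' T A
    exact ModuleFP.cokernel ((LinearMap.ker f).subtype.restrictScalars R) (f.restrictScalars R)
      Subtype.val_injective (LinearMap.exact_subtype_ker_map f) hf
      (ih hT.of_succ (LinearMap.ker f)) (ModuleFP.pi fun _ => hT)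

end Permutation

/-! ### Subgroups of finite index -/

namespace RealCharacter

variable {G : Type u} [Group G]

theorem apply_mul (χ : RealCharacter G) (a b : G) :
    χ (Additive.ofMul (a * b)) = χ (Additive.ofMul a) + χ (Additive.ofMul b) :=
  map_add χ (Additive.ofMul a) (Additive.ofMul b)

theorem apply_inv (χ : RealCharacter G) (a : G) :
    χ (Additive.ofMul a⁻¹) = -χ (Additive.ofMul a) :=
  map_neg χ (Additive.ofMul a)

theorem apply_pow (χ : RealCharacter G) (a : G) (n : ℕ) :
    χ (Additive.ofMul (a ^ n)) = n * χ (Additive.ofMul a) :=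
  (map_nsmul χ n (Additive.ofMul a)).trans (nsmul_eq_mul _ _)

end RealCharacter

section FiniteIndex

open MonoidAlgebra (single mapDomainRingHom)

/-- The trivial `ℤN`-module is of type `FP_n` in the recursive sense. -/
abbrev TrivialModuleFP (n : ℕ) (N : Type u) [Monoid N] : Prop :=
  ModuleFP (MonoidAlgebra ℤ N) n (trivialModule N)

/-- The scalars of the trivial module can be changed along any homomorphism of monoids. -/
theorem ModuleFP.trivialModule_of_compHom {n : ℕ} {N₁ N : Type u} [Monoid N₁] [Monoid N]
    [Module (MonoidAlgebra ℤ N₁) (trivialModule N)]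
    (hsmul : ∀ (s : N₁) (x : trivialModule N), single s (1 : ℤ) • x = x)
    (h : ModuleFP (MonoidAlgebra ℤ N₁) n (trivialModule N)) : TrivialModuleFP n N₁ := by
  let e : trivialModule N ≃+ trivialModule N₁ :=
    (trivialModuleEquiv N).trans (trivialModuleEquiv N₁).symm
  refine h.of_equiv (LinearEquiv.ofBijective
    (MonoidAlgebra.linearMapOfAddMonoidHom e.toAddMonoidHom fun s x => ?_) e.bijective)
  rw [hsmul, trivialModule_smul]

/-- Passage from a normal subgroup `H` of finite index to the whole group, for a submonoid `N` that
contains `g` or `g⁻¹` for all `g`. The permutation module on the cosets of `H` is induced from `H`,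
and the trivial module has a resolution by powers of this permutation module. -/
theorem TrivialModuleFP.of_normal {Γ : Type u} [Group Γ] (N : Submonoid Γ)
    (hN : ∀ g : Γ, g ∈ N ∨ g⁻¹ ∈ N) (H : Subgroup Γ) [H.Normal] [H.FiniteIndex]
    (hH : ∀ g : Γ, ∃ t ∈ N, g⁻¹ * t ∈ H) {N₁ : Type u} [Monoid N₁] (ι : N₁ →* N)
    (hι : Function.Injective ι) (hιH : ∀ t : N, (t : Γ) ∈ H ↔ ∃ s, ι s = t) {n : ℕ}
    (h : TrivialModuleFP n N₁) : TrivialModuleFP n N := by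
  let π : N →* Γ ⧸ H := (QuotientGroup.mk' H).comp N.subtype
  let φ : MonoidAlgebra ℤ N →+* MonoidAlgebra ℤ (Γ ⧸ H) := mapDomainRingHom ℤ π
  have hπ (t : N) (x : Γ ⧸ H) : t • x = π t * x := by
    induction x using QuotientGroup.induction_on with
    | H g => rfl
  have hperm : ModuleFP (MonoidAlgebra ℤ N) n (PermModule N (Γ ⧸ H)) := by
    refine PermModule.moduleFP_of_transitive ι hι (1 : Γ ⧸ H) ?_ ?_ h
    · intro x
      induction x using QuotientGroup.induction_on with
      | H g =>
        obtain ⟨t, ht, hg⟩ := hH g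
        refine ⟨⟨t, ht⟩, ?_⟩
        rw [hπ, mul_one]
        exact (QuotientGroup.eq.2 hg).symm
    · intro t t'
      rw [hπ, hπ, mul_one, mul_one]
      refine QuotientGroup.eq.trans ⟨fun hm => ?_, ?_⟩
      · rcases hN ((t : Γ)⁻¹ * t') with h1 | h1
        · obtain ⟨s, hs⟩ := (hιH ⟨_, h1⟩).1 hm
          exact ⟨s, Or.inl (Subtype.ext (by simp [hs]))⟩
        · obtain ⟨s, hs⟩ := (hιH ⟨_, h1⟩).1 (H.inv_mem hm)
          exact ⟨s, Or.inr (Subtype.ext (by simp [hs]))⟩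
      · rintro ⟨s, rfl | rfl⟩
        · simpa using (hιH _).2 ⟨s, rfl⟩
        · simpa using (hιH _).2 ⟨s, rfl⟩
  let _ : Module (MonoidAlgebra ℤ N) (MonoidAlgebra ℤ (Γ ⧸ H)) := Module.compHom _ φ
  let _ : Module (MonoidAlgebra ℤ N) (trivialModule (Γ ⧸ H)) := Module.compHom _ φ
  have : IsScalarTower (MonoidAlgebra ℤ N) (MonoidAlgebra ℤ (Γ ⧸ H))
      (MonoidAlgebra ℤ (Γ ⧸ H)) := ⟨fun r a b => mul_assoc (φ r) a b⟩
  have : IsScalarTower (MonoidAlgebra ℤ N) (MonoidAlgebra ℤ (Γ ⧸ H)) (trivialModule (Γ ⧸ H)) :=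
    ⟨fun r a b => mul_smul (φ r) a b⟩
  have hφ (t : N) : φ (single t 1) = single (π t) 1 := by simp [φ]
  have hT : ModuleFP (MonoidAlgebra ℤ N) n (MonoidAlgebra ℤ (Γ ⧸ H)) := by
    have hlift (t : N) (x : Γ ⧸ H) : (single (t • x) 1 : MonoidAlgebra ℤ (Γ ⧸ H)) =
        (single t 1 : MonoidAlgebra ℤ N) • (single x 1 : MonoidAlgebra ℤ (Γ ⧸ H)) := by
      change _ = φ (single t 1) * single x 1
      rw [hφ, MonoidAlgebra.single_mul_single, hπ, one_mul]
    let f := PermModule.lift (fun x : Γ ⧸ H => (single x 1 : MonoidAlgebra ℤ (Γ ⧸ H))) hlift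
    let e : PermModule N (Γ ⧸ H) ≃+ MonoidAlgebra ℤ (Γ ⧸ H) :=
      (PermModule.toFinsupp N).trans MonoidAlgebra.coeffAddEquiv.symm
    have hfe : f.toAddMonoidHom = e.toAddMonoidHom := PermModule.hom_ext fun x =>
      PermModule.lift_basis (fun x : Γ ⧸ H => (single x 1 : MonoidAlgebra ℤ (Γ ⧸ H))) hlift x
    refine hperm.of_equiv (LinearEquiv.ofBijective f ?_)
    have : (f : PermModule N (Γ ⧸ H) → MonoidAlgebra ℤ (Γ ⧸ H)) = e :=
      funext fun x => DFunLike.congr_fun hfe x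
    rw [this]
    exact e.bijective
  have := isNoetherianRing_monoidAlgebra (Γ ⧸ H)
  have := finite_trivialModule (Γ ⧸ H)
  refine ModuleFP.trivialModule_of_compHom ?_
    (ModuleFP.of_finite_of_isScalarTower hT (trivialModule (Γ ⧸ H)))
  intro t x
  change φ (single t 1) • x = x
  rw [hφ, trivialModule_smul]

theorem MonoidAlgebra.mapDomainRingHom_mul_single {N N₁ : Type u} [Monoid N] [Monoid N₁]
    (ι : N₁ →* N) (t : N) (y : MonoidAlgebra ℤ N₁) : mapDomainRingHom ℤ ι y * single t (1 : ℤ) =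
      ofCoeff (Finsupp.mapDomain (fun s => ι s * t) y.coeff) := by
  induction y using MonoidAlgebra.induction_linear with
  | zero => simp
  | add a b ha hb =>
    rw [map_add, add_mul, ha, hb, coeff_add, Finsupp.mapDomain_add, ofCoeff_add]
  | single n c => simp [single_mul_single, Finsupp.mapDomain_single]

theorem MonoidAlgebra.isLeftRegular_single {N : Type u} [Monoid N] [IsLeftCancelMul N] (t : N) :
    IsLeftRegular (single t (1 : ℤ)) := by
  intro x y h
  have key := single_mul_mapDomainRingHom (MonoidHom.id N) t
  simp only [mapDomainRingHom_id, RingHom.id_apply, MonoidHom.id_apply] at key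
  simp only [key] at h
  exact coeff_injective (Finsupp.mapDomain_injective (mul_right_injective t) (ofCoeff_injective h))

theorem MonoidAlgebra.isRightRegular_single {N : Type u} [Monoid N] [IsRightCancelMul N] (t : N) :
    IsRightRegular (single t (1 : ℤ)) := by
  intro x y h
  have key := mapDomainRingHom_mul_single (MonoidHom.id N) t
  simp only [mapDomainRingHom_id, RingHom.id_apply, MonoidHom.id_apply] at key
  simp only [key] at h
  exact coeff_injective (Finsupp.mapDomain_injective (mul_left_injective t) (ofCoeff_injective h))

/-- Passage from a group to a subgroup `H` of finite index, for the monoid `N` of a character `χ`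
that does not vanish on `H`. -/
theorem TrivialModuleFP.of_finiteIndex {Γ : Type u} [Group Γ] (χ : RealCharacter Γ)
    (H : Subgroup Γ) [H.FiniteIndex] (hH : ∃ y ∈ H, 0 < χ (Additive.ofMul y)) {N₁ : Type u}
    [Monoid N₁] (ι : N₁ →* χ.monoid) (hι : Function.Injective ι)
    (hιH : ∀ t : χ.monoid, (t : Γ) ∈ H ↔ ∃ s, ι s = t) {n : ℕ}
    (h : TrivialModuleFP n χ.monoid) : TrivialModuleFP n N₁ := by
  obtain ⟨y, hy, hy0⟩ := hH
  have hmem (a : Γ) : a ∈ χ.monoid ↔ 0 ≤ χ (Additive.ofMul a) := Iff.rfl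
  -- representatives `t` of the cosets `Ht` on which `χ` is non-negative
  have hrep (a : Γ ⧸ H) : ∃ t : χ.monoid, ((t : Γ)⁻¹ : Γ) = a := by
    obtain ⟨k, hk⟩ := exists_nat_ge (χ (Additive.ofMul a.out) / χ (Additive.ofMul y))
    rw [div_le_iff₀ hy0] at hk
    refine ⟨⟨y ^ k * a.out⁻¹, ?_⟩, ?_⟩
    · rw [hmem, χ.apply_mul, χ.apply_inv, χ.apply_pow]; linarith
    · refine Eq.trans ?_ (QuotientGroup.out_eq' a)
      rw [QuotientGroup.eq]
      simpa using H.pow_mem hy k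
  choose t ht using hrep
  obtain ⟨s, hs⟩ : ∃ s : χ.monoid, ∀ a,
      χ (Additive.ofMul (t a : Γ)) ≤ χ (Additive.ofMul (s : Γ)) := by
    obtain ⟨B, hB⟩ := (Set.finite_range fun a => χ (Additive.ofMul (t a : Γ))).bddAbove
    obtain ⟨k, hk⟩ := exists_nat_ge (B / χ (Additive.ofMul y))
    rw [div_le_iff₀ hy0] at hk
    refine ⟨⟨y ^ k, by rw [hmem, χ.apply_pow]; positivity⟩, fun a => ?_⟩
    rw [χ.apply_pow]
    exact (hB ⟨a, rfl⟩).trans hk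
  let φ : MonoidAlgebra ℤ N₁ →+* MonoidAlgebra ℤ χ.monoid := mapDomainRingHom ℤ ι
  let _ : Module (MonoidAlgebra ℤ N₁) (MonoidAlgebra ℤ χ.monoid) := Module.compHom _ φ
  let _ : Module (MonoidAlgebra ℤ N₁) (trivialModule χ.monoid) := Module.compHom _ φ
  have : IsScalarTower (MonoidAlgebra ℤ N₁) (MonoidAlgebra ℤ χ.monoid)
      (MonoidAlgebra ℤ χ.monoid) := ⟨fun r a b => mul_assoc (φ r) a b⟩
  have : IsScalarTower (MonoidAlgebra ℤ N₁) (MonoidAlgebra ℤ χ.monoid) (trivialModule χ.monoid) :=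
    ⟨fun r a b => mul_smul (φ r) a b⟩
  have key : IsAlmostFiniteFree (MonoidAlgebra ℤ N₁) (single s (1 : ℤ)) := by
    refine ⟨?_, ?_, MonoidAlgebra.isLeftRegular_single s, MonoidAlgebra.isRightRegular_single s, ?_⟩
    · intro r
      induction r using MonoidAlgebra.induction_linear with
      | zero => exact ⟨0, by simp⟩
      | add a b ha hb =>
        obtain ⟨a', ha⟩ := ha
        obtain ⟨b', hb⟩ := hb
        exact ⟨a' + b', by rw [add_mul, mul_add, ha, hb]⟩
      | single n c =>
        refine ⟨single ⟨(s : Γ)⁻¹ * n * s, ?_⟩ c, ?_⟩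
        · rw [hmem, χ.apply_mul, χ.apply_mul, χ.apply_inv, neg_add_cancel_comm]; exact n.2
        · rw [MonoidAlgebra.single_mul_single, MonoidAlgebra.single_mul_single, mul_comm]
          congr 1
          exact Subtype.ext (by simp [mul_assoc])
    · intro r
      induction r using MonoidAlgebra.induction_linear with
      | zero => exact ⟨0, by simp⟩
      | add a b ha hb =>
        obtain ⟨a', ha⟩ := ha
        obtain ⟨b', hb⟩ := hb
        exact ⟨a' + b', by rw [add_mul, mul_add, ha, hb]⟩
      | single n c =>
        refine ⟨single ⟨s * n * (s : Γ)⁻¹, ?_⟩ c, ?_⟩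
        · rw [hmem, χ.apply_mul, χ.apply_mul, χ.apply_inv, add_neg_cancel_comm]; exact n.2
        · rw [MonoidAlgebra.single_mul_single, MonoidAlgebra.single_mul_single, mul_comm]
          congr 1
          exact Subtype.ext (by simp [mul_assoc])
    · cases nonempty_fintype (Γ ⧸ H)
      let θ : (Γ ⧸ H → MonoidAlgebra ℤ N₁) →ₗ[MonoidAlgebra ℤ N₁] MonoidAlgebra ℤ χ.monoid :=
        Fintype.linearCombination _ fun a => single (t a) (1 : ℤ)
      have hθ (v) : θ v = ∑ a, φ (v a) * single (t a) 1 := rfl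
      refine ⟨Γ ⧸ H, inferInstance, θ, ?_, ?_⟩
      · rw [← LinearMap.ker_eq_bot, LinearMap.ker_eq_bot']
        intro v hv
        ext b h₁
        have hinj : Function.Injective fun h => ι h * t b := fun h h' e => hι (mul_right_cancel e)
        have h1 : (θ v).coeff (ι h₁ * t b) = 0 := by rw [hv]; rfl
        rw [hθ, MonoidAlgebra.coeff_sum, Finsupp.finsetSum_apply, Finset.sum_eq_single b] at h1
        · rw [MonoidAlgebra.mapDomainRingHom_mul_single] at h1
          exact (Finsupp.mapDomain_apply hinj _ h₁).symm.trans h1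
        · intro a _ hab
          rw [MonoidAlgebra.mapDomainRingHom_mul_single]
          refine Finsupp.mapDomain_of_notMem_range _ _ ?_
          rintro ⟨h₂, e⟩
          refine hab ?_
          rw [← ht a, ← ht b, QuotientGroup.eq, inv_inv]
          have e' : ((ι h₂ : Γ)) * t a = ι h₁ * t b := congrArg Subtype.val e
          have : (t a : Γ) * (t b : Γ)⁻¹ = (ι h₂ : Γ)⁻¹ * ι h₁ := by
            rw [eq_inv_mul_iff_mul_eq, ← mul_assoc, e', mul_inv_cancel_right]
          rw [this]
          exact H.mul_mem (H.inv_mem ((hιH _).2 ⟨_, rfl⟩)) ((hιH _).2 ⟨_, rfl⟩)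
        · exact fun h => absurd (Finset.mem_univ _) h
      · intro r
        induction r using MonoidAlgebra.induction_linear with
        | zero => exact ⟨0, by simp⟩
        | add a b ha hb =>
          obtain ⟨a', ha⟩ := ha
          obtain ⟨b', hb⟩ := hb
          exact ⟨a' + b', by rw [map_add, mul_add, ha, hb]⟩
        | single n c =>
          classical
          let a : Γ ⧸ H := (((s * n : χ.monoid) : Γ)⁻¹ : Γ)
          have hmH : (s * n : Γ) * (t a : Γ)⁻¹ ∈ H := by
            have : (((((s * n : χ.monoid) : Γ)⁻¹ : Γ)) : Γ ⧸ H) = ((t a : Γ)⁻¹ : Γ) := (ht a).symm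
            rw [QuotientGroup.eq, inv_inv] at this
            exact this
          have hmN : (s * n : Γ) * (t a : Γ)⁻¹ ∈ χ.monoid := by
            rw [hmem, χ.apply_mul, χ.apply_mul, χ.apply_inv]
            have h1 := hs a
            have h2 : 0 ≤ χ (Additive.ofMul (n : Γ)) := n.2
            linarith
          obtain ⟨h₁, hh₁⟩ := (hιH ⟨_, hmN⟩).1 hmH
          refine ⟨Pi.single a (single h₁ c), ?_⟩
          rw [hθ, Finset.sum_eq_single a]
          · rw [Pi.single_eq_same]
            simp only [φ, MonoidAlgebra.mapDomainRingHom_apply, MonoidAlgebra.mapDomain_single,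
              MonoidAlgebra.single_mul_single, hh₁, mul_one, one_mul]
            congr 1
            exact Subtype.ext (by simp)
          · intro b _ hb
            rw [Pi.single_eq_of_ne hb, map_zero, zero_mul]
          · exact fun h => absurd (Finset.mem_univ _) h
  have hφ (x : N₁) : φ (single x 1) = single (ι x) 1 := by simp [φ]
  refine ModuleFP.trivialModule_of_compHom ?_
    (key.moduleFP_restrictScalars (trivialModule_smul s) h)
  intro x c
  change φ (single x 1) • c = c
  rw [hφ, trivialModule_smul]

end FiniteIndex

/-! ### Projective resolutions -/

section Resolutions

/-- If the first `n + 1` terms of a resolution of `A` are of type `FP_k` for all `k`, then `A` is of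
type `FP_n`. -/
theorem ModuleFP.of_resolution {R : Type u} [Ring R] {X : ℕ → Type u} [∀ i, AddCommGroup (X i)]
    [∀ i, Module R (X i)] (d : ∀ i, X (i + 1) →ₗ[R] X i)
    (hd : ∀ i, Function.Exact (d (i + 1)) (d i)) {A : Type u} [AddCommGroup A] [Module R A]
    (ε : X 0 →ₗ[R] A) (hε : Function.Surjective ε) (h0 : Function.Exact (d 0) ε) {n : ℕ}
    (hX : ∀ i ≤ n, ∀ k, ModuleFP R k (X i)) : ModuleFP R n A := by
  have hrange (n i : ℕ) (hX : ∀ l ≤ n, ∀ k, ModuleFP R k (X (i + 1 + l))) :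
      ModuleFP R n (LinearMap.range (d i)) := by
    induction n generalizing i with
    | zero =>
      have : Module.Finite R (X (i + 1)) := hX 0 le_rfl 0
      exact inferInstanceAs (Module.Finite R (LinearMap.range (d i)))
    | succ n ih =>
      refine ModuleFP.cokernel (LinearMap.range (d (i + 1))).subtype (d i).rangeRestrict
        Subtype.val_injective ?_ (d i).surjective_rangeRestrict (ih (i + 1) fun l hl k => ?_)
        (hX 0 (by omega) _)
      · intro x
        rw [← LinearMap.mem_ker, LinearMap.ker_rangeRestrict, (LinearMap.exact_iff.1 (hd i))]
        exact ⟨fun h => ⟨⟨x, h⟩, rfl⟩, fun ⟨y, hy⟩ => hy ▸ y.2⟩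
      · have := hX (l + 1) (by omega) k
        rwa [show i + 1 + (l + 1) = i + 1 + 1 + l by omega] at this
  cases n with
  | zero => exact @Module.Finite.of_surjective _ _ _ _ _ _ _ _ _ _ _ (hX 0 le_rfl 0) ε hε
  | succ n =>
    refine ModuleFP.cokernel (LinearMap.range (d 0)).subtype ε Subtype.val_injective ?_ hε
      (hrange n 0 fun l hl k => hX _ (by omega) k) (hX 0 (by omega) _)
    intro x
    exact (h0 x).trans ⟨fun h => ⟨⟨x, h⟩, rfl⟩, fun ⟨y, hy⟩ => hy ▸ y.2⟩

/-- Construction of a projective resolution one syzygy at a time, keeping track of a property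
`Good n` of the `n`-th syzygy. -/
theorem isOfTypeFP_of_step {C : Type*} [Category C] [Abelian C] (fg : C → Prop) (m : ℕ∞)
    (Good : ℕ → C → Prop)
    (step : ∀ n A, Good n A → ∃ (B P : C) (i : B ⟶ P) (f : P ⟶ A) (w : i ≫ f = 0),
      (ShortComplex.mk i f w).ShortExact ∧ Projective P ∧ ((n : ℕ∞) ≤ m → fg P) ∧ Good (n + 1) B)
    (A : C) (hA : Good 0 A) : IsOfTypeFP fg m A := by
  choose B P i f w hex hproj hfg hgood using step
  let st (n : ℕ) : {A // Good n A} :=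
    Nat.rec ⟨A, hA⟩ (fun n a => ⟨B n a.1 a.2, hgood n a.1 a.2⟩) n
  let X (n : ℕ) : C := P n (st n).1 (st n).2
  let ι (n : ℕ) : (st (n + 1)).1 ⟶ X n := i n (st n).1 (st n).2
  let ε (n : ℕ) : X n ⟶ (st n).1 := f n (st n).1 (st n).2
  have hw (n : ℕ) : ι n ≫ ε n = 0 := w n _ _
  have hε (n : ℕ) : Epi (ε n) := (hex n _ (st n).2).epi_g
  have hι (n : ℕ) : Mono (ι n) := (hex n _ (st n).2).mono_f
  have hexact (n : ℕ) : (ShortComplex.mk (ι n) (ε n) (hw n)).Exact := (hex n _ (st n).2).exact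
  have hexact' (n : ℕ) : (ShortComplex.mk (ε (n + 1) ≫ ι n) (ε n)
      (by rw [Category.assoc, hw, Limits.comp_zero])).Exact := by
    let α : ShortComplex.mk (ε (n + 1) ≫ ι n) (ε n) (by rw [Category.assoc, hw, Limits.comp_zero]) ⟶
        ShortComplex.mk (ι n) (ε n) (hw n) :=
      { τ₁ := ε (n + 1), τ₂ := 𝟙 _, τ₃ := 𝟙 _ }
    have : Epi α.τ₁ := hε (n + 1)
    have : IsIso α.τ₂ := inferInstanceAs (IsIso (𝟙 _))
    have : Mono α.τ₃ := inferInstanceAs (Mono (𝟙 _))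
    exact (ShortComplex.exact_iff_of_epi_of_isIso_of_mono α).2 (hexact n)
  have hzero (n : ℕ) : (ε (n + 2) ≫ ι (n + 1)) ≫ ε (n + 1) ≫ ι n = 0 := by
    rw [Category.assoc, reassoc_of% hw (n + 1), Limits.zero_comp, Limits.comp_zero]
  have hexact'' (n : ℕ) : (ShortComplex.mk (ε (n + 2) ≫ ι (n + 1)) (ε (n + 1) ≫ ι n)
      (hzero n)).Exact := by
    let α : ShortComplex.mk (ε (n + 2) ≫ ι (n + 1)) (ε (n + 1))
          (by rw [Category.assoc, hw, Limits.comp_zero]) ⟶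
        ShortComplex.mk (ε (n + 2) ≫ ι (n + 1)) (ε (n + 1) ≫ ι n) (hzero n) :=
      { τ₁ := 𝟙 _, τ₂ := 𝟙 _, τ₃ := ι n }
    have : Epi α.τ₁ := inferInstanceAs (Epi (𝟙 _))
    have : IsIso α.τ₂ := inferInstanceAs (IsIso (𝟙 _))
    have : Mono α.τ₃ := hι n
    exact (ShortComplex.exact_iff_of_epi_of_isIso_of_mono α).1 (hexact' (n + 1))
  let K : ChainComplex C ℕ := ChainComplex.of X (fun n => ε (n + 1) ≫ ι n) hzero
  have hd (n : ℕ) : K.d (n + 1) n = ε (n + 1) ≫ ι n :=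
    ChainComplex.of_d X (fun n => ε (n + 1) ≫ ι n) n
  let π : K ⟶ (ChainComplex.single₀ C).obj A := (ChainComplex.toSingle₀Equiv _ _).symm
    ⟨ε 0, by rw [hd, Category.assoc, hw, Limits.comp_zero]⟩
  have hπ : π.f 0 = ε 0 := ChainComplex.toSingle₀Equiv_symm_apply_f_zero _ _
  refine ⟨⟨K, fun n => hproj n _ _, π, ⟨?_⟩⟩, fun n hn => hfg n _ _ hn⟩
  · rintro (_ | n)
    · rw [ChainComplex.quasiIsoAt₀_iff, ShortComplex.quasiIso_iff_of_zeros']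
      · refine (ShortComplex.exact_and_epi_g_iff_of_iso ?_).2 ⟨hexact' 0, hε 0⟩
        exact ShortComplex.isoMk (Iso.refl _) (Iso.refl _) (Iso.refl _)
          ((Category.id_comp _).trans ((hd 0).symm.trans (Category.comp_id _).symm))
          ((Category.id_comp _).trans (hπ.symm.trans (Category.comp_id _).symm))
      all_goals rfl
    · rw [quasiIsoAt_iff_exactAt']
      · rw [HomologicalComplex.exactAt_iff' _ (n + 1 + 1) (n + 1) n (by simp) (by simp)]
        exact ShortComplex.exact_of_iso (S₁ := ShortComplex.mk _ _ (hzero n))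
          (ShortComplex.isoMk (Iso.refl _) (Iso.refl _) (Iso.refl _)
          ((Category.id_comp _).trans ((hd (n + 1)).trans (Category.comp_id _).symm))
          ((Category.id_comp _).trans ((hd n).trans (Category.comp_id _).symm))) (hexact'' n)
      · apply ChainComplex.exactAt_succ_single_obj

/-- A monoid is of type `FP_m` if and only if the trivial module is so in the recursive sense. -/
theorem monoidIsFP_iff {m : ℕ∞} {M : Type u} [Monoid M] :
    MonoidIsFP m M ↔ ∀ n : ℕ, (n : ℕ∞) ≤ m → TrivialModuleFP n M := by
  constructor
  · rintro ⟨P, hP⟩ n hn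
    let ε : P.complex.X 0 ⟶ trivialModule M := P.π.f 0
    have hε : Epi ε := inferInstanceAs (Epi (P.π.f 0))
    refine ModuleFP.of_resolution (X := fun i => P.complex.X i)
      (fun i => (P.complex.d (i + 1) i).hom) (fun i => ?_)
      ε.hom ?_ ?_ fun i hi k => ?_
    · exact (ShortComplex.ShortExact.moduleCat_exact_iff_function_exact _).1 (P.exact_succ i)
    · exact (ModuleCat.epi_iff_surjective ε).1 hε
    · exact (ShortComplex.ShortExact.moduleCat_exact_iff_function_exact _).1 P.exact₀
    · have := hP i (le_trans (by exact_mod_cast hi) hn)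
      have : Module.Projective (MonoidAlgebra ℤ M) (P.complex.X i) :=
        (IsProjective.iff_projective _).2 (P.projective i)
      exact ModuleFP.of_projective k
  · intro h
    refine isOfTypeFP_of_step _ m (fun n (A : ModuleCat.{u} (MonoidAlgebra ℤ M)) =>
      ∀ k : ℕ, ((n + k : ℕ) : ℕ∞) ≤ m →
      ModuleFP (MonoidAlgebra ℤ M) k A) ?_ _ (by simpa using h)
    intro n A hA
    by_cases hn : (n : ℕ∞) ≤ m
    · obtain ⟨k, f, hf⟩ := @Module.Finite.exists_fin' _ _ _ _ _ (hA 0 hn)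
      refine ⟨ModuleCat.of _ (LinearMap.ker f), ModuleCat.of _ (Fin k → MonoidAlgebra ℤ M),
        ModuleCat.ofHom (LinearMap.ker f).subtype, ModuleCat.ofHom f, ?_, ?_, ?_, ?_, ?_⟩
      · ext x; exact x.2
      · have := (ModuleCat.mono_iff_injective
          (ModuleCat.ofHom (LinearMap.ker f).subtype)).2 Subtype.val_injective
        have := (ModuleCat.epi_iff_surjective (ModuleCat.ofHom f)).2 hf
        exact { exact := (ShortComplex.ShortExact.moduleCat_exact_iff_function_exact _).2
                  (LinearMap.exact_subtype_ker_map f) }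
      · exact (IsProjective.iff_projective _).1 inferInstance
      · exact fun _ => inferInstanceAs (Module.Finite _ (Fin k → MonoidAlgebra ℤ M))
      · intro l hl
        exact ModuleFP.kernel (LinearMap.ker f).subtype f Subtype.val_injective
          (LinearMap.exact_subtype_ker_map f) hf (ModuleFP.pi_fin l k)
          (hA (l + 1) (by rwa [add_assoc, add_comm 1 l] at hl))
    · refine ⟨Limits.kernel (Projective.π A), Projective.over A, Limits.kernel.ι _, Projective.π A,
        Limits.kernel.condition _, ?_, inferInstance, fun h => absurd h hn, fun l hl => ?_⟩
      · exact { exact := ShortComplex.exact_kernel _ }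
      · exact absurd (le_trans (by exact_mod_cast (by omega : n ≤ n + 1 + l)) hl) hn

end Resolutions

/-! ### The orbit category of a cancellative monoid -/

namespace FinSubgroup

variable {M : Type u} [Monoid M]

/-- The coset of `1`. -/
def base (K : FinSubgroup M) : K.Coset := ⟨K.toSet, 1, (one_smul _ _).symm⟩

theorem exists_smul_base {K : FinSubgroup M} (S : K.Coset) : ∃ m : M, S = m • K.base := by
  obtain ⟨S, m, rfl⟩ := S
  exact ⟨m, rfl⟩

theorem one_mem (K : FinSubgroup M) : (1 : M) ∈ K.toSet := K.toSubmonoid.one_mem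

theorem mul_mem (K : FinSubgroup M) {a b : M} (ha : a ∈ K.toSet) (hb : b ∈ K.toSet) :
    a * b ∈ K.toSet := K.toSubmonoid.mul_mem ha hb

theorem smul_toSet (K : FinSubgroup M) {k : M} (hk : k ∈ K.toSet) : k • K.toSet = K.toSet := by
  obtain ⟨y, hy, hky, -⟩ := K.exists_inv k hk
  refine Set.Subset.antisymm ?_ fun x hx => ⟨y * x, K.mul_mem hy hx, ?_⟩
  · rintro _ ⟨x, hx, rfl⟩
    exact K.mul_mem hk hx
  · change k * (y * x) = x
    rw [← mul_assoc, hky, one_mul]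

theorem smul_base (K : FinSubgroup M) {k : M} (hk : k ∈ K.toSet) : k • K.base = K.base :=
  Subtype.ext (K.smul_toSet hk)

theorem smul_base_eq_iff {K : FinSubgroup M} {a b : M} :
    a • K.base = b • K.base ↔ ∃ k ∈ K.toSet, a = b * k := by
  constructor
  · intro h
    have : a ∈ b • K.toSet := by
      have h1 : a • K.toSet = b • K.toSet := congrArg Subtype.val h
      rw [← h1]
      exact ⟨1, K.one_mem, mul_one a⟩
    obtain ⟨k, hk, hka⟩ := this
    exact ⟨k, hk, hka.symm⟩
  · rintro ⟨k, hk, rfl⟩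
    rw [mul_smul, K.smul_base hk]

/-- The `M`-map underlying a morphism of the orbit category. -/
def toMap {K H : FinSubgroup M} (f : K ⟶ H) : K.Coset →[M] H.Coset := f

/-- The value of a morphism at the coset of `1`, which determines the morphism. -/
def baseImage {K H : FinSubgroup M} (f : K ⟶ H) : H.Coset := toMap f K.base

theorem apply_smul_base {K H : FinSubgroup M} (f : K ⟶ H) (m : M) :
    toMap f (m • K.base) = m • baseImage f :=
  map_smul (toMap f) m K.base

theorem hom_ext {K H : FinSubgroup M} {f g : K ⟶ H} (h : baseImage f = baseImage g) : f = g := by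
  refine MulActionHom.ext (f := toMap f) (g := toMap g) fun S => ?_
  obtain ⟨m, rfl⟩ := exists_smul_base S
  rw [apply_smul_base, apply_smul_base, h]

theorem smul_baseImage {K H : FinSubgroup M} (f : K ⟶ H) {k : M} (hk : k ∈ K.toSet) :
    k • baseImage f = baseImage f := by
  rw [← apply_smul_base, K.smul_base hk]; rfl

theorem baseImage_comp {K H L : FinSubgroup M} (f : K ⟶ H) (g : H ⟶ L) {m : M}
    (hf : baseImage f = m • H.base) : baseImage (f ≫ g) = m • baseImage g := by
  rw [← apply_smul_base, ← hf]; rfl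

/-- The morphism `M/K → M/H` which sends the coset of `1` to `mH`, for `Km ⊆ mH`. -/
theorem exists_hom (K H : FinSubgroup M) (m : M)
    (hm : ∀ k ∈ K.toSet, ∃ h ∈ H.toSet, k * m = m * h) :
    ∃ f : K ⟶ H, baseImage f = m • H.base := by
  have hfix {k : M} (hk : k ∈ K.toSet) : k • m • H.base = m • H.base := by
    rw [← mul_smul, smul_base_eq_iff]
    exact hm k hk
  choose r hr using fun S : K.Coset => exists_smul_base S
  have hwd (a : M) : r (a • K.base) • m • H.base = a • m • H.base := by
    obtain ⟨k, hk, hak⟩ := smul_base_eq_iff.1 (hr (a • K.base))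
    refine Eq.trans ?_ (congrArg (· • m • H.base) hak).symm
    rw [mul_smul, hfix hk]
  refine ⟨({ toFun := fun S => r S • m • H.base, map_smul' := fun a S => ?_ } :
    K.Coset →[M] H.Coset), ?_⟩
  · obtain ⟨b, rfl⟩ := exists_smul_base S
    change r (a • b • K.base) • m • H.base = a • r (b • K.base) • m • H.base
    rw [← mul_smul a b K.base, hwd, hwd, mul_smul]
  · have := hwd 1
    rw [one_smul, one_smul] at this
    exact this

/-- The monoid of the elements `n` with `Kn = nK`. -/
def normalizer (K : FinSubgroup M) : Submonoid M where
  carrier := {n | K.toSet * {n} = {n} * K.toSet}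
  one_mem' := by
    change K.toSet * {1} = {1} * K.toSet
    rw [Set.singleton_one, mul_one, one_mul]
  mul_mem' {a b} ha hb := by
    change K.toSet * {a * b} = {a * b} * K.toSet
    rw [← Set.singleton_mul_singleton, ← mul_assoc, show K.toSet * {a} = {a} * K.toSet from ha,
      mul_assoc, show K.toSet * {b} = {b} * K.toSet from hb, mul_assoc]

theorem mem_normalizer {K : FinSubgroup M} {n : M} :
    n ∈ K.normalizer ↔ K.toSet * {n} = {n} * K.toSet := Iff.rfl

theorem exists_mul_eq {A B : Set M} {m : M} (h : A * {m} = {m} * B) {k : M} (hk : k ∈ A) :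
    ∃ x ∈ B, k * m = m * x := by
  have : k * m ∈ {m} * B := h ▸ Set.mul_mem_mul hk rfl
  obtain ⟨_, rfl, x, hx, e⟩ := this
  exact ⟨x, hx, e.symm⟩

/-- The endomorphism of `M/K` given by an element of the normalizer. -/
noncomputable def normalizerHom (K : FinSubgroup M) (n : K.normalizer) : K ⟶ K :=
  (K.exists_hom K n fun _ hk => exists_mul_eq n.2 hk).choose

theorem baseImage_normalizerHom (K : FinSubgroup M) (n : K.normalizer) :
    baseImage (K.normalizerHom n) = (n : M) • K.base :=
  (K.exists_hom K n fun _ hk => exists_mul_eq n.2 hk).choose_spec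

theorem normalizerHom_one (K : FinSubgroup M) : K.normalizerHom 1 = 𝟙 K :=
  hom_ext ((K.baseImage_normalizerHom 1).trans (one_smul _ _))

theorem normalizerHom_mul (K : FinSubgroup M) (a b : K.normalizer) :
    K.normalizerHom (a * b) = K.normalizerHom a ≫ K.normalizerHom b :=
  hom_ext <| (K.baseImage_normalizerHom (a * b)).trans <| by
    refine Eq.symm ((baseImage_comp _ _ (K.baseImage_normalizerHom a)).trans ?_)
    rw [baseImage_normalizerHom, ← mul_smul]; rfl

/-- The normalizer of `K` acts on the set of morphisms from `M/K` to the members of a family. -/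
noncomputable instance {ι : Type u} (K : FinSubgroup M) (H : ι → FinSubgroup M) :
    MulAction K.normalizer (Σ j, (K ⟶ H j)) where
  smul n x := ⟨x.1, K.normalizerHom n ≫ x.2⟩
  one_smul x := by
    change (⟨x.1, K.normalizerHom 1 ≫ x.2⟩ : Σ j, (K ⟶ H j)) = x
    rw [normalizerHom_one, Category.id_comp]
  mul_smul a b x := by
    change (⟨x.1, K.normalizerHom (a * b) ≫ x.2⟩ : Σ j, (K ⟶ H j)) =
      ⟨x.1, K.normalizerHom a ≫ K.normalizerHom b ≫ x.2⟩
    rw [normalizerHom_mul, Category.assoc]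

theorem smul_hom {ι : Type u} {K : FinSubgroup M} {H : ι → FinSubgroup M} (n : K.normalizer)
    (x : Σ j, (K ⟶ H j)) : n • x = ⟨x.1, K.normalizerHom n ≫ x.2⟩ := rfl

theorem baseImage_normalizerHom_comp {K H : FinSubgroup M} (n : K.normalizer) (f : K ⟶ H) :
    baseImage (K.normalizerHom n ≫ f) = (n : M) • baseImage f :=
  baseImage_comp _ _ (K.baseImage_normalizerHom n)

/-- The set of the subgroups `m⁻¹Km` of `H`, where `mH` corresponds to `f : M/K → M/H`. They form a
conjugacy class of `H`, and classify `f` up to the action of the normalizer of `K`. -/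
def conjClass {K H : FinSubgroup M} (f : K ⟶ H) : Set (Set M) :=
  {L | ∃ m ∈ (baseImage f).1, K.toSet * {m} = {m} * L}

theorem exists_mul_eq_of_baseImage {K H : FinSubgroup M} {f : K ⟶ H} {m : M}
    (hf : baseImage f = m • H.base) : ∀ k ∈ K.toSet, ∃ h ∈ H.toSet, k * m = m * h := by
  intro k hk
  have := smul_baseImage f hk
  rw [hf, ← mul_smul] at this
  exact smul_base_eq_iff.1 this

variable [IsLeftCancelMul M]

theorem singleton_mul_cancel {m : M} {A B : Set M} (h : {m} * A = {m} * B) : A = B := by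
  rw [Set.singleton_mul, Set.singleton_mul] at h
  exact (mul_right_injective m).image_injective h

theorem conjClass_eq {K H : FinSubgroup M} {f : K ⟶ H} {m : M} (hf : baseImage f = m • H.base)
    {L : Set M} (hL : K.toSet * {m} = {m} * L) :
    conjClass f = {L' | ∃ x ∈ H.toSet, L * {x} = {x} * L'} := by
  have key (x : M) (L' : Set M) :
      K.toSet * {m * x} = {m * x} * L' ↔ L * {x} = {x} * L' := by
    rw [← Set.singleton_mul_singleton, ← mul_assoc, hL, mul_assoc, mul_assoc]
    exact ⟨singleton_mul_cancel, fun h => by rw [h]⟩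
  ext L'
  constructor
  · rintro ⟨_, hm', h⟩
    rw [hf] at hm'
    obtain ⟨x, hx, rfl⟩ := hm'
    exact ⟨x, hx, (key x L').1 h⟩
  · rintro ⟨x, hx, h⟩
    exact ⟨m * x, by rw [hf]; exact ⟨x, hx, rfl⟩, (key x L').2 h⟩

/-- The conjugate `m⁻¹Km` of a finite subgroup, for `Km ⊆ mH`. -/
theorem exists_conj {K H : FinSubgroup M} {m : M}
    (hm : ∀ k ∈ K.toSet, ∃ h ∈ H.toSet, k * m = m * h) :
    ∃ L : FinSubgroup M, L.toSet ⊆ H.toSet ∧ K.toSet * {m} = {m} * L.toSet := by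
  have hsub : {x : M | ∃ k ∈ K.toSet, k * m = m * x} ⊆ H.toSet := by
    rintro x ⟨k, hk, hx⟩
    obtain ⟨h, hh, e⟩ := hm k hk
    rwa [mul_left_cancel (hx.symm.trans e)]
  have : Finite H.toSet := H.finite
  refine ⟨⟨⟨⟨{x | ∃ k ∈ K.toSet, k * m = m * x}, ?_⟩, ⟨1, K.one_mem, by simp⟩⟩,
    (Set.toFinite H.toSet).subset hsub, ?_⟩, hsub, ?_⟩
  · rintro x y ⟨k, hk, hx⟩ ⟨l, hl, hy⟩
    exact ⟨k * l, K.mul_mem hk hl, by rw [mul_assoc, hy, ← mul_assoc, hx, mul_assoc]⟩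
  · rintro x ⟨k, hk, hx⟩
    obtain ⟨l, hl, hkl, hlk⟩ := K.exists_inv k hk
    obtain ⟨y, -, hy⟩ := hm l hl
    refine ⟨y, ⟨l, hl, hy⟩, mul_left_cancel (a := m) ?_, mul_left_cancel (a := m) ?_⟩
    · rw [← mul_assoc, ← hx, mul_assoc, ← hy, ← mul_assoc, hkl, one_mul, mul_one]
    · rw [← mul_assoc, ← hy, mul_assoc, ← hx, ← mul_assoc, hlk, one_mul, mul_one]
  · ext z
    constructor
    · rintro ⟨k, hk, m', hm', rfl⟩
      obtain rfl : m' = m := hm'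
      obtain ⟨h, hh, e⟩ := hm k hk
      exact ⟨m', rfl, h, ⟨k, hk, e⟩, e.symm⟩
    · rintro ⟨m', hm', x, ⟨k, hk, e⟩, rfl⟩
      obtain rfl : m' = m := hm'
      exact ⟨k, hk, m', rfl, e⟩

/-- For a monoid that conjugates finite subgroups, the morphisms from `M/K` to the members of a
finite family form finitely many orbits under the normalizer of `K`, with finite stabilizers. -/
theorem permModule_hom (hM : ConjugatesFiniteSubgroups M) {ι : Type u} [Finite ι]
    (K : FinSubgroup M) (H : ι → FinSubgroup M) (n : ℕ) :
    ModuleFP (MonoidAlgebra ℤ K.normalizer) n (PermModule K.normalizer (Σ j, (K ⟶ H j))) := by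
  let c₀ : (Σ j, (K ⟶ H j)) → ι × Set (Set M) := fun x => (x.1, conjClass x.2)
  have hfin : (Set.range c₀).Finite := by
    have hH (j : ι) : (𝒫 (𝒫 (H j).toSet)).Finite := by
      have : Finite (H j).toSet := (H j).finite
      exact (Set.toFinite _).powerset.powerset
    refine (Set.finite_univ.prod (Set.finite_iUnion hH)).subset ?_
    rintro _ ⟨⟨j, f⟩, rfl⟩
    refine ⟨trivial, Set.mem_iUnion.2 ⟨j, ?_⟩⟩
    intro L hL x hx
    obtain ⟨m₀, hm₀⟩ := exists_smul_base (baseImage f)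
    obtain ⟨m, hm, e⟩ := hL
    have hm' : baseImage f = m • (H j).base := by
      rw [hm₀] at hm ⊢
      obtain ⟨y, hy, rfl⟩ := hm
      change _ = (m₀ * y) • (H j).base
      rw [mul_smul, (H j).smul_base hy]
    have hmx : m * x ∈ K.toSet * {m} := e ▸ Set.mul_mem_mul rfl hx
    obtain ⟨k, hk, _, rfl, e'⟩ := hmx
    obtain ⟨h, hh, e''⟩ := exists_mul_eq_of_baseImage hm' k hk
    rwa [← mul_left_cancel (e''.symm.trans e')]
  have : Finite (Set.range c₀) := hfin
  refine PermModule.moduleFP_of_finite_stabilizers (fun x => (⟨c₀ x, x, rfl⟩ : Set.range c₀))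
    ?_ ?_ n
  · rintro n ⟨j, f⟩
    obtain ⟨m, hm⟩ := exists_smul_base (baseImage f)
    obtain ⟨L, -, hL⟩ := exists_conj (exists_mul_eq_of_baseImage hm)
    have hnm : baseImage (K.normalizerHom n ≫ f) = ((n : M) * m) • (H j).base := by
      rw [baseImage_normalizerHom_comp, hm, mul_smul]
    refine Subtype.ext (Prod.ext rfl ?_)
    change conjClass (K.normalizerHom n ≫ f) = conjClass f
    rw [conjClass_eq hm hL, conjClass_eq hnm]
    rw [← Set.singleton_mul_singleton, ← mul_assoc, mem_normalizer.1 n.2, mul_assoc, hL, mul_assoc]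
  · rintro ⟨j, f⟩
    obtain ⟨m, hm⟩ := exists_smul_base (baseImage f)
    obtain ⟨L, hLH, hL⟩ := exists_conj (exists_mul_eq_of_baseImage hm)
    -- the coset `mH` is replaced by a coset `hH` with `h` invertible and `h⁻¹Kh = m⁻¹Km`
    obtain ⟨h, hh⟩ := hM K L ⟨m, by rw [← Set.mul_singleton, ← Set.singleton_mul, hL]⟩
    have hhL : K.toSet * {(h : M)} = {(h : M)} * L.toSet := by
      rw [← hh]
      ext z
      constructor
      · rintro ⟨k, hk, _, rfl, rfl⟩
        exact ⟨_, rfl, _, ⟨k, hk, rfl⟩, by simp [← mul_assoc]⟩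
      · rintro ⟨_, rfl, _, ⟨k, hk, rfl⟩, rfl⟩
        exact ⟨k, hk, _, rfl, by simp [← mul_assoc]⟩
    obtain ⟨f₀, hf₀⟩ := K.exists_hom (H j) h fun k hk => by
      obtain ⟨x, hx, e⟩ := exists_mul_eq hhL hk
      exact ⟨x, hLH hx, e⟩
    have hc : conjClass f₀ = conjClass f := by rw [conjClass_eq hm hL, conjClass_eq hf₀ hhL]
    refine ⟨⟨j, f₀⟩, Subtype.ext (Prod.ext rfl hc), ?_, ?_⟩
    · rintro ⟨j', f'⟩ hy
      have hy' : c₀ ⟨j', f'⟩ = c₀ ⟨j, f⟩ := congrArg Subtype.val hy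
      obtain rfl : j' = j := congrArg Prod.fst hy'
      have hf' : conjClass f' = conjClass f := congrArg Prod.snd hy'
      have hLf' : L.toSet ∈ conjClass f' := by
        rw [hf', conjClass_eq hm hL]
        exact ⟨1, (H j').one_mem, by simp⟩
      obtain ⟨m', hm', e⟩ := hLf'
      have hm'' : baseImage f' = m' • (H j').base := by
        obtain ⟨m₀, hm₀⟩ := exists_smul_base (baseImage f')
        rw [hm₀] at hm' ⊢
        obtain ⟨y, hy, rfl⟩ := hm'
        change _ = (m₀ * y) • (H j').base
        rw [mul_smul, (H j').smul_base hy]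
      have hinv : {(↑h⁻¹ : M)} * K.toSet = L.toSet * {(↑h⁻¹ : M)} := by
        refine singleton_mul_cancel (m := (h : M)) ?_
        rw [← mul_assoc, Set.singleton_mul_singleton, Units.mul_inv, Set.singleton_one, one_mul,
          ← mul_assoc, ← hhL, mul_assoc, Set.singleton_mul_singleton, Units.mul_inv,
          Set.singleton_one, mul_one]
      refine ⟨⟨m' * ↑h⁻¹, ?_⟩, ?_⟩
      · rw [mem_normalizer, ← Set.singleton_mul_singleton, ← mul_assoc, e, mul_assoc, ← hinv,
          mul_assoc]
      · rw [smul_hom]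
        refine congrArg (Sigma.mk j') (hom_ext ?_)
        change baseImage _ = baseImage f'
        rw [baseImage_normalizerHom_comp, hf₀, hm'', ← mul_smul, Units.inv_mul_cancel_right]
    · let F : Submonoid K.normalizer :=
        { carrier := {n | ∃ x ∈ (H j).toSet, (n : M) * h = h * x}
          one_mem' := ⟨1, (H j).one_mem, by simp⟩
          mul_mem' := by
            rintro a b ⟨x, hx, e⟩ ⟨y, hy, e'⟩
            exact ⟨x * y, (H j).mul_mem hx hy, by
              rw [Submonoid.coe_mul, mul_assoc, e', ← mul_assoc, e, mul_assoc]⟩ }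
      refine ⟨F, ?_, ?_⟩
      · have : Finite (H j).toSet := (H j).finite
        choose x hx e using fun n : F => n.2
        refine Finite.of_injective (fun n : F => (⟨x n, hx n⟩ : (H j).toSet)) fun a b hab => ?_
        have hab' : x a = x b := congrArg Subtype.val hab
        have : ((a : K.normalizer) : M) * h = (b : K.normalizer) * h := by rw [e, e, hab']
        exact Subtype.ext (Subtype.ext ((Units.mul_left_inj h).1 this))
      · intro t t'
        have hiff : t • (⟨j, f₀⟩ : Σ j, (K ⟶ H j)) = t' • ⟨j, f₀⟩ ↔
            ((t : M) * h) • (H j).base = ((t' : M) * h) • (H j).base := by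
          rw [mul_smul, mul_smul, ← hf₀, ← baseImage_normalizerHom_comp,
            ← baseImage_normalizerHom_comp, smul_hom, smul_hom]
          constructor
          · intro e
            rw [eq_of_heq (Sigma.mk.inj e).2]
          · intro e
            exact congrArg (Sigma.mk j) (hom_ext e)
        rw [hiff]
        constructor
        · rw [eq_comm, smul_base_eq_iff]
          rintro ⟨x, hx, e⟩
          have e' : (t' : M) = t * (h * x * ↑h⁻¹) := by
            rw [← Units.mul_left_inj h, e]
            simp [mul_assoc]
          have hmem : h * x * ↑h⁻¹ ∈ K.normalizer := by
            refine singleton_mul_cancel (m := (t : M)) ?_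
            rw [← mul_assoc, ← mem_normalizer.1 t.2, mul_assoc, Set.singleton_mul_singleton, ← e',
              mem_normalizer.1 t'.2, ← mul_assoc, Set.singleton_mul_singleton, ← e']
          exact ⟨⟨⟨_, hmem⟩, x, hx, by simp [mul_assoc]⟩, Or.inl (Subtype.ext e')⟩
        · rintro ⟨⟨s, x, hx, e⟩, rfl | rfl⟩
          · rw [eq_comm, smul_base_eq_iff]
            exact ⟨x, hx, by simp [mul_assoc, e]⟩
          · rw [smul_base_eq_iff]
            exact ⟨x, hx, by simp [mul_assoc, e]⟩

end FinSubgroup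

/-! ### Evaluation of Bredon modules, and free Bredon modules -/

namespace BredonModule

open MonoidAlgebra (single)

section Eval

variable {M : Type u} [Monoid M]

/-- The action of the normalizer of `K` on the value `U(M/K)` of a Bredon module. -/
noncomputable def evalRepresentation (U : BredonModule M) (K : FinSubgroup M) :
    Representation ℤ K.normalizer (U.obj (Opposite.op K)) where
  toFun n := (U.map (K.normalizerHom n).op).hom.toIntLinearMap
  map_one' := by
    ext x
    change U.map (K.normalizerHom 1).op x = x
    rw [FinSubgroup.normalizerHom_one, op_id, U.map_id]; rfl
  map_mul' a b := by
    ext x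
    change U.map (K.normalizerHom (a * b)).op x =
      U.map (K.normalizerHom a).op (U.map (K.normalizerHom b).op x)
    rw [FinSubgroup.normalizerHom_mul, op_comp, U.map_comp]; rfl

/-- The value `U(M/K)` of a Bredon module, as a left module over the monoid ring of the normalizer
of `K`. -/
abbrev eval (U : BredonModule M) (K : FinSubgroup M) : Type u := (evalRepresentation U K).asModule

theorem single_smul_eval (U : BredonModule M) (K : FinSubgroup M) (n : K.normalizer)
    (x : eval U K) :
    single n (1 : ℤ) • x = (U.map (K.normalizerHom n).op).hom x :=
  (Representation.single_smul (evalRepresentation U K) 1 n x).trans (one_smul ℤ _)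

/-- A morphism of Bredon modules, evaluated at `M/K`. -/
noncomputable def evalMap {U V : BredonModule M} (f : U ⟶ V) (K : FinSubgroup M) :
    eval U K →ₗ[MonoidAlgebra ℤ K.normalizer] eval V K :=
  MonoidAlgebra.linearMapOfAddMonoidHom (f.app (Opposite.op K)).hom fun n x => by
    rw [single_smul_eval, single_smul_eval]
    exact ConcreteCategory.congr_hom (f.naturality (K.normalizerHom n).op) x

theorem evalMap_comp {U V W : BredonModule M} (f : U ⟶ V) (g : V ⟶ W) (K : FinSubgroup M) :
    evalMap (f ≫ g) K = evalMap g K ∘ₗ evalMap f K := rfl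

theorem evalMap_id (U : BredonModule M) (K : FinSubgroup M) :
    evalMap (𝟙 U) K = LinearMap.id := rfl

theorem evalMap_injective {U V : BredonModule M} (f : U ⟶ V) [Mono f] (K : FinSubgroup M) :
    Function.Injective (evalMap f K) :=
  (AddCommGrpCat.mono_iff_injective _).1 (inferInstanceAs (Mono (f.app (Opposite.op K))))

theorem evalMap_surjective {U V : BredonModule M} (f : U ⟶ V) [Epi f] (K : FinSubgroup M) :
    Function.Surjective (evalMap f K) :=
  (AddCommGrpCat.epi_iff_surjective _).1 (inferInstanceAs (Epi (f.app (Opposite.op K))))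

theorem epi_of_surjective {U V : BredonModule M} (f : U ⟶ V)
    (h : ∀ K, Function.Surjective (evalMap f K)) : Epi f := by
  have (K : (FinSubgroup M)ᵒᵖ) : Epi (f.app K) :=
    (AddCommGrpCat.epi_iff_surjective _).2 (h K.unop)
  exact NatTrans.epi_of_epi_app f

theorem evalMap_exact {S : ShortComplex (BredonModule M)} (h : S.Exact) (K : FinSubgroup M) :
    Function.Exact (evalMap S.f K) (evalMap S.g K) :=
  (ShortComplex.ab_exact_iff_function_exact _).1
    (h.map ((evaluation _ AddCommGrpCat.{u}).obj (Opposite.op K)))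

/-- The values of the trivial Bredon module are trivial modules. -/
noncomputable def evalTrivialEquiv (K : FinSubgroup M) :
    eval (trivialBredonModule M) K ≃ₗ[MonoidAlgebra ℤ K.normalizer]
      trivialModule K.normalizer :=
  LinearEquiv.ofBijective
    (MonoidAlgebra.linearMapOfAddMonoidHom
      ((Representation.asModuleEquiv
        (Representation.trivial ℤ K.normalizer (ULift.{u} ℤ))).symm.toAddEquiv.toAddMonoidHom.comp
        (Representation.asModuleEquiv
          (evalRepresentation (trivialBredonModule M) K)).toAddEquiv.toAddMonoidHom)
      fun n x => by
        rw [single_smul_eval]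
        exact (trivialModule_smul (N := K.normalizer) n _).symm)
    Function.bijective_id

end Eval

section Free

variable {M : Type u} [Monoid M] {ι : Type u} (H : ι → FinSubgroup M)

/-- The free Bredon module on a family of generators, the generator `j` being in degree
`M/H j`. -/
noncomputable def free : BredonModule M where
  obj K := AddCommGrpCat.of ((Σ j, (K.unop ⟶ H j)) →₀ ℤ)
  map f := AddCommGrpCat.ofHom
    (Finsupp.mapDomain.addMonoidHom fun x => ⟨x.1, f.unop ≫ x.2⟩)
  map_id K := by
    ext x
    · simp
  map_comp f g := by
    ext x
    · simp

/-- The basis of the value of a free Bredon module at `M/K`. -/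
noncomputable def freeBasis {K : (FinSubgroup M)ᵒᵖ} (x : Σ j, (K.unop ⟶ H j)) : (free H).obj K :=
  (Finsupp.single x 1 : (Σ j, (K.unop ⟶ H j)) →₀ ℤ)

theorem free_map_freeBasis {K L : (FinSubgroup M)ᵒᵖ} (f : K ⟶ L) (x : Σ j, (K.unop ⟶ H j)) :
    (free H).map f (freeBasis H x) = freeBasis H ⟨x.1, f.unop ≫ x.2⟩ :=
  Finsupp.mapDomain_single

/-- The generators of a free Bredon module. -/
noncomputable def generator (j : ι) : (free H).obj (Opposite.op (H j)) :=
  freeBasis H (K := Opposite.op (H j)) ⟨j, 𝟙 (H j)⟩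

theorem free_map_generator {K : (FinSubgroup M)ᵒᵖ} (x : Σ j, (K.unop ⟶ H j)) :
    (free H).map x.2.op (generator H x.1) = freeBasis H x := by
  rw [generator, free_map_freeBasis]
  exact congrArg (fun f => freeBasis H (⟨x.1, f⟩ : Σ j, (K.unop ⟶ H j))) (Category.comp_id x.2)

variable {H}

theorem free_addHom_ext {K : (FinSubgroup M)ᵒᵖ} {A : AddCommGrpCat.{u}}
    {f g : (free H).obj K ⟶ A} (h : ∀ x, f (freeBasis H x) = g (freeBasis H x)) : f = g := by
  refine AddCommGrpCat.hom_ext (Finsupp.addHom_ext' fun x => ?_)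
  ext
  exact h x

theorem free_hom_ext {U : BredonModule M} {f g : free H ⟶ U}
    (h : ∀ j, f.app _ (generator H j) = g.app _ (generator H j)) : f = g := by
  ext K : 2
  refine free_addHom_ext fun x => ?_
  rw [← free_map_generator, NatTrans.naturality_apply, NatTrans.naturality_apply, h]

/-- The homomorphism out of the value of a free Bredon module which takes the generators to the
given elements. -/
noncomputable def liftApp {U : BredonModule M} (x : ∀ j, U.obj (Opposite.op (H j)))
    (K : (FinSubgroup M)ᵒᵖ) : (free H).obj K ⟶ U.obj K :=
  AddCommGrpCat.ofHom (Finsupp.liftAddHom fun y : Σ j, (K.unop ⟶ H j) =>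
    zmultiplesHom (U.obj K) (U.map y.2.op (x y.1)))

theorem liftApp_freeBasis {U : BredonModule M} (x : ∀ j, U.obj (Opposite.op (H j)))
    {K : (FinSubgroup M)ᵒᵖ} (y : Σ j, (K.unop ⟶ H j)) :
    liftApp x K (freeBasis H y) = U.map y.2.op (x y.1) :=
  (Finsupp.liftAddHom_apply_single (fun y : Σ j, (K.unop ⟶ H j) =>
    zmultiplesHom (U.obj K) (U.map y.2.op (x y.1))) _ _).trans (one_smul ℤ _)

/-- The morphism out of a free Bredon module with given values on the generators. -/
noncomputable def lift {U : BredonModule M} (x : ∀ j, U.obj (Opposite.op (H j))) : free H ⟶ U where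
  app := liftApp x
  naturality K L f := free_addHom_ext fun y => by
    rw [ConcreteCategory.comp_apply, ConcreteCategory.comp_apply, free_map_freeBasis,
      liftApp_freeBasis, liftApp_freeBasis]
    change U.map (y.2.op ≫ f) (x y.1) = _
    rw [U.map_comp, ConcreteCategory.comp_apply]

theorem lift_generator {U : BredonModule M} (x : ∀ j, U.obj (Opposite.op (H j))) (j : ι) :
    (lift x).app _ (generator H j) = x j := by
  refine (liftApp_freeBasis x _).trans ?_
  change U.map (𝟙 _) (x j) = x j
  rw [U.map_id]; rfl

instance : Projective (free H) where
  factors {U V} f e _ := by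
    choose x hx using fun j => evalMap_surjective e (H j) (f.app _ (generator H j))
    refine ⟨lift (U := U) x, free_hom_ext fun j => ?_⟩
    rw [NatTrans.comp_app, ConcreteCategory.comp_apply]
    exact (congrArg (e.app _) (lift_generator (U := U) x j)).trans (hx j)

theorem isFG_free [Finite ι] : (free H).IsFG := by
  refine ⟨fun K => {y | ∃ j, ∃ h : Opposite.op (H j) = K, y = h ▸ generator H j}, fun K => ?_, ?_,
    fun V hV hS K => ?_⟩
  · have : {y | ∃ j, ∃ h : Opposite.op (H j) = K, y = h ▸ generator H j} ⊆
        Set.range fun j : {j // Opposite.op (H j) = K} =>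
          (j.2 ▸ generator H j.1 : (free H).obj K) := by
      rintro _ ⟨j, h, rfl⟩
      exact ⟨⟨j, h⟩, rfl⟩
    exact (Set.finite_range _).subset this
  · refine (Set.finite_range fun j => Opposite.op (H j)).subset ?_
    rintro K ⟨_, j, h, -⟩
    exact ⟨j, h⟩
  · have hb (x : Σ j, (K.unop ⟶ H j)) : freeBasis H x ∈ V K := by
      rw [← free_map_generator]
      exact hV _ _ _ _ (hS _ ⟨x.1, rfl, rfl⟩)
    have : QuotientAddGroup.mk' (V K) = 0 := by
      have := free_addHom_ext (A := AddCommGrpCat.of ((free H).obj K ⧸ V K))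
        (f := AddCommGrpCat.ofHom (QuotientAddGroup.mk' (V K))) (g := 0) fun x =>
          (QuotientAddGroup.eq_zero_iff _).2 (hb x)
      exact congrArg AddCommGrpCat.Hom.hom this
    refine top_unique fun y _ => ?_
    exact (QuotientAddGroup.eq_zero_iff y).1 (DFunLike.congr_fun this y)

/-- The values of a free Bredon module are permutation modules. -/
noncomputable def evalFreeEquiv (H : ι → FinSubgroup M) (K : FinSubgroup M) :
    PermModule K.normalizer (Σ j, (K ⟶ H j)) ≃ₗ[MonoidAlgebra ℤ K.normalizer] eval (free H) K :=
  LinearEquiv.ofBijective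
    (MonoidAlgebra.linearMapOfAddMonoidHom
      ((evalRepresentation (free H) K).asModuleEquiv.symm.toAddEquiv.toAddMonoidHom.comp
        (PermModule.toFinsupp K.normalizer).toAddMonoidHom)
      fun n x => by
        refine Eq.trans ?_ (single_smul_eval (free H) K n _).symm
        exact (Representation.single_smul (permRepresentation K.normalizer (Σ j, (K ⟶ H j)))
          1 n x).trans (one_smul ℤ _))
    Function.bijective_id

theorem moduleFP_eval_free [IsLeftCancelMul M] (hM : ConjugatesFiniteSubgroups M) [Finite ι]
    (H : ι → FinSubgroup M) (K : FinSubgroup M) (n : ℕ) :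
    ModuleFP (MonoidAlgebra ℤ K.normalizer) n (eval (free H) K) :=
  (FinSubgroup.permModule_hom hM K H n).of_equiv (evalFreeEquiv H K)

/-- A finitely generated Bredon module is a quotient of a free module of finite rank. -/
theorem IsFG.exists_epi {U : BredonModule M} (hU : U.IsFG) :
    ∃ (ι : Type u) (_ : Finite ι) (H : ι → FinSubgroup M) (p : free H ⟶ U), Epi p := by
  obtain ⟨S, hfin, hsupp, hS⟩ := hU
  let s : Set (Σ K, U.obj K) := {p | p.2 ∈ S p.1}
  have : Finite s := by
    refine ((hsupp.biUnion fun K _ => (hfin K).image (Sigma.mk K)).subset ?_).to_subtype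
    rintro ⟨K, x⟩ hx
    exact Set.mem_biUnion (show K ∈ {K | (S K).Nonempty} from ⟨x, hx⟩) ⟨x, hx, rfl⟩
  let H (p : s) : FinSubgroup M := p.1.1.unop
  let x (p : s) : U.obj (Opposite.op (H p)) := p.1.2
  refine ⟨s, this, H, lift x, epi_of_surjective _ fun K => ?_⟩
  have htop := hS (fun K => ((lift x).app K).hom.range) ?_ ?_
  · exact fun y => (htop (Opposite.op K)).ge (AddSubgroup.mem_top y)
  · rintro K L f _ ⟨y, rfl⟩
    exact ⟨(free H).map f y, NatTrans.naturality_apply (lift x) f y⟩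
  · intro K y hy
    exact ⟨generator H (⟨⟨K, y⟩, hy⟩ : s), lift_generator x ⟨⟨K, y⟩, hy⟩⟩

theorem moduleFP_eval_of_projective [IsLeftCancelMul M] (hM : ConjugatesFiniteSubgroups M)
    {U : BredonModule M} [Projective U] (hU : U.IsFG) (K : FinSubgroup M) (n : ℕ) :
    ModuleFP (MonoidAlgebra ℤ K.normalizer) n (eval U K) := by
  obtain ⟨ι, _, H, p, _⟩ := hU.exists_epi
  refine ModuleFP.of_retract (evalMap (Projective.factorThru (𝟙 U) p) K) (evalMap p K) ?_
    (moduleFP_eval_free hM H K n)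
  rw [← evalMap_comp, Projective.factorThru_comp, evalMap_id]

/-- Every Bredon module is a quotient of a free module. -/
theorem exists_free_epi (U : BredonModule M) :
    ∃ (ι : Type u) (H : ι → FinSubgroup M) (p : free H ⟶ U), Epi p := by
  let H (x : Σ K, U.obj (Opposite.op K)) : FinSubgroup M := x.1
  exact ⟨_, H, lift fun x => x.2, epi_of_surjective _ fun K y =>
    ⟨generator H ⟨K, y⟩, lift_generator (H := H) (fun x => x.2) ⟨K, y⟩⟩⟩

/-- If every orbit is a retract of one of finitely many orbits `M/R j`, then a Bredon module is a
quotient of a free module of finite rank as soon as its values at the `M/R j` are finitely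
generated. -/
theorem exists_finite_free_epi {ι : Type u} [Finite ι] (R : ι → FinSubgroup M)
    (hR : ∀ L : FinSubgroup M, ∃ (j : ι) (f : L ⟶ R j) (g : R j ⟶ L), f ≫ g = 𝟙 L)
    (U : BredonModule M)
    (hU : ∀ j, Module.Finite (MonoidAlgebra ℤ (R j).normalizer) (eval U (R j))) :
    ∃ (κ : Type u) (_ : Finite κ) (H : κ → FinSubgroup M) (p : free H ⟶ U), Epi p := by
  choose s hs using fun j => (hU j).fg_top
  let H (x : Σ j, s j) : FinSubgroup M := R x.1
  let p : free H ⟶ U := lift fun x => (x.2.1 : eval U (R x.1))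
  refine ⟨_, inferInstance, H, p, epi_of_surjective _ fun L y => ?_⟩
  have hsurj (j : ι) : Function.Surjective (evalMap p (R j)) := by
    rw [← LinearMap.range_eq_top, ← top_le_iff, ← hs j, Submodule.span_le]
    exact fun x hx => ⟨generator H ⟨j, x, hx⟩,
      lift_generator (H := H) (fun x => (x.2.1 : eval U (R x.1))) ⟨j, x, hx⟩⟩
  obtain ⟨j, f, g, hfg⟩ := hR L
  obtain ⟨z, hz⟩ := hsurj j (U.map g.op y)
  refine ⟨(free H).map f.op z, (NatTrans.naturality_apply p f.op z).trans ?_⟩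
  have hid : U.map g.op ≫ U.map f.op = 𝟙 _ := by
    rw [← U.map_comp, ← op_comp, hfg, op_id, U.map_id]
  exact (congrArg (U.map f.op) hz).trans (ConcreteCategory.congr_hom hid y)

end Free

/-- A monoid of Bredon type `FP_m` which conjugates finite subgroups has normalizers of type
`FP_m`. -/
theorem trivialModuleFP_normalizer {M : Type u} [Monoid M] [IsLeftCancelMul M] {m : ℕ∞}
    (hM : ConjugatesFiniteSubgroups M) (h : MonoidIsBredonFP m M) (K : FinSubgroup M) {n : ℕ}
    (hn : (n : ℕ∞) ≤ m) : TrivialModuleFP n K.normalizer := by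
  obtain ⟨P, hP⟩ := h
  let ε : P.complex.X 0 ⟶ trivialBredonModule M := P.π.f 0
  have hε : Epi ε := inferInstanceAs (Epi (P.π.f 0))
  refine ModuleFP.of_equiv (evalTrivialEquiv K) ?_
  refine ModuleFP.of_resolution (X := fun i => eval (P.complex.X i) K)
    (fun i => evalMap (P.complex.d (i + 1) i) K) (fun i => evalMap_exact (P.exact_succ i) K)
    (evalMap ε K) (evalMap_surjective ε K) (evalMap_exact P.exact₀ K) fun i hi k => ?_
  have := P.projective i
  exact moduleFP_eval_of_projective hM (hP i (le_trans (by exact_mod_cast hi) hn)) K k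

/-- If `M` conjugates finite subgroups, every orbit is a retract of one of finitely many orbits, and
the normalizers of the finite subgroups are of type `FP_m`, then `M` is of Bredon type `FP_m`. -/
theorem monoidIsBredonFP_of_normalizer {M : Type u} [Monoid M] [IsLeftCancelMul M] {m : ℕ∞}
    (hM : ConjugatesFiniteSubgroups M) {ι : Type u} [Finite ι] (R : ι → FinSubgroup M)
    (hR : ∀ L : FinSubgroup M, ∃ (j : ι) (f : L ⟶ R j) (g : R j ⟶ L), f ≫ g = 𝟙 L)
    (h : ∀ (K : FinSubgroup M) (n : ℕ), (n : ℕ∞) ≤ m → TrivialModuleFP n K.normalizer) :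
    MonoidIsBredonFP m M := by
  refine isOfTypeFP_of_step _ m (fun n (U : BredonModule M) => ∀ (K : FinSubgroup M) (k : ℕ),
    ((n + k : ℕ) : ℕ∞) ≤ m → ModuleFP (MonoidAlgebra ℤ K.normalizer) k (eval U K)) ?_ _
    fun K k hk => (h K k (by simpa using hk)).of_equiv (evalTrivialEquiv K).symm
  intro n U hU
  by_cases hn : (n : ℕ∞) ≤ m
  · obtain ⟨κ, _, H, p, _⟩ := exists_finite_free_epi R hR U fun j => hU (R j) 0 hn
    have hex : (ShortComplex.mk (Limits.kernel.ι p) p (Limits.kernel.condition p)).ShortExact :=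
      { exact := ShortComplex.exact_kernel p }
    refine ⟨_, _, _, p, _, hex, inferInstance, fun _ => isFG_free, fun K k hk => ?_⟩
    exact ModuleFP.kernel (evalMap (Limits.kernel.ι p) K) (evalMap p K) (evalMap_injective _ K)
      (evalMap_exact hex.exact K) (evalMap_surjective p K) (moduleFP_eval_free hM H K k)
      (hU K (k + 1) (by rwa [add_assoc, add_comm 1 k] at hk))
  · obtain ⟨κ, H, p, _⟩ := exists_free_epi U
    refine ⟨_, _, Limits.kernel.ι p, p, Limits.kernel.condition p,
      { exact := ShortComplex.exact_kernel p }, inferInstance, fun h => absurd h hn,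
      fun K k hk => absurd (le_trans (by exact_mod_cast (by omega : n ≤ n + 1 + k)) hk) hn⟩

end BredonModule

/-! ### Characters and subgroups of finite index -/

namespace RealCharacter

variable {G : Type u} [Group G]

theorem mem_kernel (χ : RealCharacter G) {g : G} : g ∈ χ.kernel ↔ χ (Additive.ofMul g) = 0 :=
  Iff.rfl

theorem apply_eq_zero_of_mem (χ : RealCharacter G) {K : Subgroup G} [Finite K] {g : G}
    (hg : g ∈ K) : χ (Additive.ofMul g) = 0 := by
  obtain ⟨n, hn, h⟩ := (isOfFinOrder_of_finite (⟨g, hg⟩ : K)).exists_pow_eq_one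
  have h' : g ^ n = 1 := congrArg Subtype.val h
  have := apply_pow χ g n
  rw [h', ofMul_one, map_zero, zero_eq_mul] at this
  exact this.resolve_left (by exact_mod_cast hn.ne')

/-- A non-zero character is positive somewhere on every subgroup of finite index. -/
theorem exists_pos_of_finiteIndex {χ : RealCharacter G} (hχ : χ ≠ 0) (F : Subgroup G)
    [hF : F.FiniteIndex] : ∃ y ∈ F, 0 < χ (Additive.ofMul y) := by
  obtain ⟨g, hg⟩ : ∃ g : G, χ (Additive.ofMul g) ≠ 0 := by
    by_contra! h
    exact hχ (DFunLike.ext _ _ h)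
  obtain ⟨n, hn, -, hmem⟩ := Subgroup.exists_pow_mem_of_index_ne_zero hF.index_ne_zero g
  have h0 : χ (Additive.ofMul (g ^ n)) ≠ 0 := by
    rw [apply_pow]
    exact mul_ne_zero (by exact_mod_cast hn.ne') hg
  rcases h0.lt_or_gt with h | h
  · exact ⟨(g ^ n)⁻¹, F.inv_mem hmem, by rw [apply_inv]; exact neg_pos.2 h⟩
  · exact ⟨_, hmem, h⟩

/-- The type `FP_n` of the monoid `G_χ` is inherited by, and can be checked on, a normal subgroup of
finite index. -/
theorem trivialModuleFP_iff {χ : RealCharacter G} (hχ : χ ≠ 0) (F : Subgroup G) [F.Normal]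
    [F.FiniteIndex] {N₁ : Type u} [Monoid N₁] (ι : N₁ →* χ.monoid) (hι : Function.Injective ι)
    (hιF : ∀ t : χ.monoid, (t : G) ∈ F ↔ ∃ s, ι s = t) {n : ℕ} :
    TrivialModuleFP n N₁ ↔ TrivialModuleFP n χ.monoid := by
  obtain ⟨y, hyF, hy⟩ := exists_pos_of_finiteIndex hχ F
  refine ⟨TrivialModuleFP.of_normal χ.monoid (fun g => ?_) F (fun g => ?_) ι hι hιF,
    TrivialModuleFP.of_finiteIndex χ F ⟨y, hyF, hy⟩ ι hι hιF⟩
  · rcases le_total 0 (χ (Additive.ofMul g)) with h | h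
    · exact Or.inl h
    · refine Or.inr (?_ : 0 ≤ χ (Additive.ofMul g⁻¹))
      rw [apply_inv]
      exact neg_nonneg.2 h
  · obtain ⟨k, hk⟩ := Archimedean.arch (-χ (Additive.ofMul g)) hy
    refine ⟨g * y ^ k, (?_ : 0 ≤ χ (Additive.ofMul (g * y ^ k))), ?_⟩
    · rw [nsmul_eq_mul] at hk
      rw [apply_mul, apply_pow]
      linarith
    · rw [inv_mul_cancel_left]
      exact F.pow_mem hyF k

/-- The monoid `G₁ ∩ G_χ`. -/
abbrev monoidOf (χ : RealCharacter G) (G₁ : Subgroup G) : Submonoid G₁ :=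
  χ.monoid.comap G₁.subtype

end RealCharacter

/-! ### Finite subgroups of the monoid of a character -/

namespace FinSubgroup

variable {G : Type u} [Group G] {χ : RealCharacter G} {G₁ : Subgroup G}

/-- A finite subgroup of the monoid `G₁ ∩ G_χ`, as a subgroup of `G`. -/
def toSubgroup (K : FinSubgroup (χ.monoidOf G₁)) : Subgroup G where
  carrier := {g | ∃ x ∈ K.toSet, x.1.1 = g}
  one_mem' := ⟨1, K.one_mem, rfl⟩
  mul_mem' := by
    rintro _ _ ⟨x, hx, rfl⟩ ⟨y, hy, rfl⟩
    exact ⟨x * y, K.mul_mem hx hy, rfl⟩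
  inv_mem' := by
    rintro _ ⟨x, hx, rfl⟩
    obtain ⟨y, hy, hxy, -⟩ := K.exists_inv x hx
    refine ⟨y, hy, eq_inv_of_mul_eq_one_right ?_⟩
    exact congrArg (fun z : χ.monoidOf G₁ => z.1.1) hxy

theorem mem_toSubgroup {K : FinSubgroup (χ.monoidOf G₁)} {x : χ.monoidOf G₁} :
    x.1.1 ∈ K.toSubgroup ↔ x ∈ K.toSet := by
  refine ⟨?_, fun h => ⟨x, h, rfl⟩⟩
  rintro ⟨y, hy, e⟩
  rwa [← show y = x from Subtype.ext (Subtype.ext e)]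

theorem finite_toSubgroup (K : FinSubgroup (χ.monoidOf G₁)) : Finite K.toSubgroup := by
  have : Finite K.toSet := K.finite
  refine Finite.of_surjective (fun x : K.toSet => (⟨x.1.1.1, x.1, x.2, rfl⟩ : K.toSubgroup)) ?_
  rintro ⟨_, x, hx, rfl⟩
  exact ⟨⟨x, hx⟩, rfl⟩

theorem exists_toSubgroup_eq (L : Subgroup G) [Finite L] (hL : L ≤ G₁) :
    ∃ K : FinSubgroup (χ.monoidOf G₁), K.toSubgroup = L := by
  have hmem {g : G} (hg : g ∈ L) : 0 ≤ χ (Additive.ofMul g) := (χ.apply_eq_zero_of_mem hg).ge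
  refine ⟨⟨⟨⟨{x | x.1.1 ∈ L}, fun ha hb => L.mul_mem ha hb⟩, L.one_mem⟩, ?_, ?_⟩, ?_⟩
  · exact Finite.of_injective (fun x => (⟨x.1.1.1, x.2⟩ : L)) fun x y h =>
      Subtype.ext (Subtype.ext (Subtype.ext (congrArg (fun z : L => (z : G)) h)))
  · intro x hx
    exact ⟨⟨⟨x.1.1⁻¹, hL (L.inv_mem hx)⟩, hmem (L.inv_mem hx)⟩, L.inv_mem hx,
      Subtype.ext (Subtype.ext (mul_inv_cancel x.1.1)),
      Subtype.ext (Subtype.ext (inv_mul_cancel x.1.1))⟩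
  · ext g
    constructor
    · rintro ⟨x, hx, rfl⟩
      exact hx
    · intro hg
      exact ⟨⟨⟨g, hL hg⟩, hmem hg⟩, hg, rfl⟩

theorem mul_singleton_eq_iff {H₁ H₂ : FinSubgroup (χ.monoidOf G₁)} {g : χ.monoidOf G₁} :
    H₁.toSet * {g} = {g} * H₂.toSet ↔ H₁.toSubgroup = MulAut.conj g.1.1 • H₂.toSubgroup := by
  constructor
  · intro h
    ext k
    rw [Subgroup.mem_smul_pointwise_iff_exists]
    constructor
    · rintro ⟨x, hx, rfl⟩
      obtain ⟨y, hy, e⟩ := exists_mul_eq h hx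
      refine ⟨y.1.1, ⟨y, hy, rfl⟩, mul_inv_eq_of_eq_mul ?_⟩
      exact congrArg (fun z : χ.monoidOf G₁ => z.1.1) e.symm
    · rintro ⟨_, ⟨y, hy, rfl⟩, rfl⟩
      have : g * y ∈ H₁.toSet * {g} := h ▸ Set.mul_mem_mul rfl hy
      obtain ⟨x, hx, g', hg', e⟩ := this
      obtain rfl : g' = g := hg'
      refine ⟨x, hx, eq_mul_inv_of_mul_eq ?_⟩
      exact congrArg (fun z : χ.monoidOf G₁ => z.1.1) e
  · intro h
    ext z
    rw [Set.mul_singleton, Set.singleton_mul]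
    constructor
    · rintro ⟨x, hx, rfl⟩
      have hx' := mem_toSubgroup.2 hx
      rw [h, Subgroup.mem_smul_pointwise_iff_exists] at hx'
      obtain ⟨_, ⟨y, hy, rfl⟩, e⟩ := hx'
      exact ⟨y, hy, Subtype.ext (Subtype.ext (eq_mul_of_mul_inv_eq e))⟩
    · rintro ⟨y, hy, rfl⟩
      have hy' : g.1.1 * y.1.1 * g.1.1⁻¹ ∈ H₁.toSubgroup := by
        rw [h, Subgroup.mem_smul_pointwise_iff_exists]
        exact ⟨_, mem_toSubgroup.2 hy, rfl⟩
      obtain ⟨x, hx, e⟩ := hy'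
      exact ⟨x, hx, Subtype.ext (Subtype.ext (mul_eq_of_eq_mul_inv e))⟩

theorem image_conj_eq_iff {M : Type u} [Monoid M] {A B : Set M} (h : Mˣ) :
    (fun x => (↑h⁻¹ : M) * x * (h : M)) '' A = B ↔ A * {(h : M)} = {(h : M)} * B := by
  rw [← (Units.mulLeft h).injective.image_injective.eq_iff, Set.image_image, Set.mul_singleton,
    Set.singleton_mul]
  simp [Units.mulLeft, ← mul_assoc]

/-- In terms of subgroups of `G`: the monoid `G₁ ∩ G_χ` conjugates finite subgroups if finite
subgroups which are conjugate by some `g ∈ G₁` with `χ(g) ≥ 0` are conjugate by some `h ∈ G₁` with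
`χ(h) = 0`. -/
theorem conjugatesFiniteSubgroups_iff : ConjugatesFiniteSubgroups (χ.monoidOf G₁) ↔
    ∀ H₁ H₂ : FinSubgroup (χ.monoidOf G₁), ∀ g ∈ G₁, 0 ≤ χ (Additive.ofMul g) →
      H₁.toSubgroup = MulAut.conj g • H₂.toSubgroup →
      ∃ h ∈ G₁, χ (Additive.ofMul h) = 0 ∧ H₁.toSubgroup = MulAut.conj h • H₂.toSubgroup := by
  refine forall₂_congr fun H₁ H₂ => ⟨fun hM g hg hχ h => ?_, ?_⟩
  · obtain ⟨u, hu⟩ := hM ⟨⟨⟨g, hg⟩, hχ⟩, by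
      rw [← Set.mul_singleton, ← Set.singleton_mul, mul_singleton_eq_iff]; exact h⟩
    rw [image_conj_eq_iff, mul_singleton_eq_iff] at hu
    refine ⟨u.1.1.1, u.1.1.2, le_antisymm ?_ u.1.2, hu⟩
    have h0 : 0 ≤ χ (Additive.ofMul (u⁻¹).1.1.1) := (u⁻¹).1.2
    have hinv : (u⁻¹).1.1.1 = u.1.1.1⁻¹ := eq_inv_of_mul_eq_one_right
      (congrArg (fun z : χ.monoidOf G₁ => z.1.1) u.mul_inv)
    rw [hinv, RealCharacter.apply_inv] at h0
    linarith
  · rintro hM ⟨g, hg⟩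
    rw [← Set.mul_singleton, ← Set.singleton_mul, mul_singleton_eq_iff] at hg
    obtain ⟨h, hh, hχ, e⟩ := hM g.1.1 g.1.2 g.2 hg
    refine ⟨⟨⟨⟨h, hh⟩, hχ.ge⟩, ⟨⟨h⁻¹, G₁.inv_mem hh⟩,
      ((RealCharacter.apply_inv χ h).trans (neg_eq_zero.2 hχ)).ge⟩,
      Subtype.ext (Subtype.ext (mul_inv_cancel h)),
      Subtype.ext (Subtype.ext (inv_mul_cancel h))⟩, ?_⟩
    rw [image_conj_eq_iff, mul_singleton_eq_iff]
    exact e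

theorem conj_smul_eq_self_iff {K : Subgroup G} {g : G} :
    K = MulAut.conj g • K ↔ g ∈ Subgroup.normalizer (K : Set G) := by
  rw [← Subgroup.inv_mem_iff, Subgroup.mem_normalizer_iff, SetLike.ext_iff]
  refine forall_congr' fun k => iff_congr Iff.rfl ?_
  rw [Subgroup.mem_pointwise_smul_iff_inv_smul_mem, ← map_inv]
  rfl

theorem mem_normalizer_iff {K : FinSubgroup (χ.monoidOf G₁)} {x : χ.monoidOf G₁} :
    x ∈ K.normalizer ↔ x.1.1 ∈ Subgroup.normalizer (K.toSubgroup : Set G) :=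
  mul_singleton_eq_iff.trans conj_smul_eq_self_iff

/-- The normalizer of `K` in the monoid `G₁ ∩ G_χ` is `G₁ ∩ N_G(K)_χ`, hence is of type `FP_n` if
and only if `N_G(K)_χ` is. -/
theorem trivialModuleFP_normalizer_iff [G₁.Normal] [G₁.FiniteIndex]
    (K : FinSubgroup (χ.monoidOf G₁))
    (hχ : χ.restrict (Subgroup.normalizer (K.toSubgroup : Set G)) ≠ 0) {n : ℕ} :
    TrivialModuleFP n K.normalizer ↔
      TrivialModuleFP n (χ.restrict (Subgroup.normalizer (K.toSubgroup : Set G))).monoid := by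
  refine RealCharacter.trivialModuleFP_iff hχ (G₁.subgroupOf _)
    { toFun := fun x => ⟨⟨x.1.1.1, mem_normalizer_iff.1 x.2⟩, x.1.2⟩
      map_one' := rfl
      map_mul' := fun _ _ => rfl } (fun x y h => ?_) fun t => ⟨fun h => ?_, ?_⟩
  · exact Subtype.ext (Subtype.ext (Subtype.ext (congrArg (fun z => z.1.1) h)))
  · exact ⟨⟨⟨⟨t.1.1, h⟩, t.2⟩, mem_normalizer_iff.2 t.1.2⟩, rfl⟩
  · rintro ⟨x, rfl⟩
    exact x.1.1.2

end FinSubgroup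

/-! ### Normalizers and centralizers -/

section Restriction

variable {G : Type u} [Group G] {m : ℕ∞} {χ : RealCharacter G}

theorem restrictionInSigma_iff {H : Subgroup G} : RestrictionInSigma m χ H ↔
    χ.restrict H ≠ 0 ∧ ∀ n : ℕ, (n : ℕ∞) ≤ m → TrivialModuleFP n (χ.restrict H).monoid := by
  rw [← monoidIsFP_iff]
  exact ⟨fun ⟨h, h'⟩ => ⟨h, h'⟩, fun ⟨h, h'⟩ => ⟨h, h'⟩⟩

theorem restrict_ne_zero {H : Subgroup G} {g : G} (hg : g ∈ H) (h : χ (Additive.ofMul g) ≠ 0) :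
    χ.restrict H ≠ 0 :=
  fun h0 => h (DFunLike.congr_fun h0 (Additive.ofMul ⟨g, hg⟩))

/-- The centralizer of a finite subgroup has finite index in the normalizer, so that both lie in the
domain of the Sigma invariant at the same time. -/
theorem restrictionInSigma_centralizer_iff (K : Subgroup G) [Finite K] :
    RestrictionInSigma m χ (Subgroup.centralizer (K : Set G)) ↔
      RestrictionInSigma m χ (Subgroup.normalizer (K : Set G)) := by
  let N := Subgroup.normalizer (K : Set G)
  let C := Subgroup.centralizer (K : Set G)
  have hCN : C ≤ N := Subgroup.centralizer_le_normalizer _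
  have hker := Subgroup.normalizerMonoidHom_ker K
  have : Finite (MulAut K) := inferInstance
  have hnormal : (C.subgroupOf N).Normal := hker ▸ inferInstance
  have hindex : (C.subgroupOf N).FiniteIndex := hker ▸ Subgroup.finiteIndex_ker _
  have hne : χ.restrict C ≠ 0 ↔ χ.restrict N ≠ 0 := by
    constructor
    · intro h
      obtain ⟨y, -, hy⟩ := RealCharacter.exists_pos_of_finiteIndex h ⊤
      exact restrict_ne_zero (hCN y.2) hy.ne'
    · intro h
      obtain ⟨y, hyC, hy⟩ := RealCharacter.exists_pos_of_finiteIndex h (C.subgroupOf N)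
      exact restrict_ne_zero hyC hy.ne'
  rw [restrictionInSigma_iff, restrictionInSigma_iff]
  have key (hN : χ.restrict N ≠ 0) (n : ℕ) :
      TrivialModuleFP n (χ.restrict C).monoid ↔ TrivialModuleFP n (χ.restrict N).monoid := by
    refine RealCharacter.trivialModuleFP_iff hN (C.subgroupOf N)
      { toFun := fun x => ⟨⟨x.1.1, hCN x.1.2⟩, x.2⟩
        map_one' := rfl
        map_mul' := fun _ _ => rfl } (fun x y h => ?_) fun t => ⟨fun h => ?_, ?_⟩
    · exact Subtype.ext (Subtype.ext (congrArg (fun z => z.1.1) h))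
    · exact ⟨⟨⟨t.1.1, h⟩, t.2⟩, rfl⟩
    · rintro ⟨x, rfl⟩
      exact x.1.2
  exact ⟨fun h => ⟨hne.1 h.1, fun n hn => (key (hne.1 h.1) n).1 (h.2 n hn)⟩,
    fun h => ⟨hne.2 h.1, fun n hn => (key h.1 n).2 (h.2 n hn)⟩⟩

/-- The condition `N_{G₁}(K) (ker χ ∩ G₁) = G₁` says that `χ` takes the same values on `N_{G₁}(K)`
as on `G₁`. -/
theorem normalizer_mul_kernel_eq_iff {K G₁ : Subgroup G} :
    ((Subgroup.normalizer (K : Set G) ⊓ G₁ : Subgroup G) : Set G) *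
        ((χ.kernel ⊓ G₁ : Subgroup G) : Set G) = (G₁ : Set G) ↔
      ∀ g ∈ G₁, ∃ n ∈ G₁, K = MulAut.conj n • K ∧ χ (Additive.ofMul n) = χ (Additive.ofMul g) := by
  constructor
  · intro h g hg
    rw [← SetLike.mem_coe, ← h] at hg
    obtain ⟨n, hn, k, hk, rfl⟩ := hg
    refine ⟨n, hn.2, FinSubgroup.conj_smul_eq_self_iff.2 hn.1, ?_⟩
    change _ = χ (Additive.ofMul (n * k))
    rw [RealCharacter.apply_mul, χ.mem_kernel.1 hk.1, add_zero]
  · intro h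
    ext g
    constructor
    · rintro ⟨n, hn, k, hk, rfl⟩
      exact G₁.mul_mem hn.2 hk.2
    · intro hg
      obtain ⟨n, hn, hK, e⟩ := h g hg
      refine ⟨n, ⟨FinSubgroup.conj_smul_eq_self_iff.1 hK, hn⟩, n⁻¹ * g,
        ⟨χ.mem_kernel.2 ?_, G₁.mul_mem (G₁.inv_mem hn) hg⟩, mul_inv_cancel_left n g⟩
      rw [RealCharacter.apply_mul, RealCharacter.apply_inv, e, neg_add_cancel]

/-- The monoid `G₁ ∩ G_χ` conjugates finite subgroups if and only if
`N_{G₁}(K) (ker χ ∩ G₁) = G₁` for all finite subgroups `K`. -/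
theorem conjugatesFiniteSubgroups_iff_normalizer {G₁ : Subgroup G}
    (hfin : ∀ K : Subgroup G, Finite K → K ≤ G₁) :
    ConjugatesFiniteSubgroups (χ.monoidOf G₁) ↔ ∀ K : Subgroup G, Finite K →
      ((Subgroup.normalizer (K : Set G) ⊓ G₁ : Subgroup G) : Set G) *
        ((χ.kernel ⊓ G₁ : Subgroup G) : Set G) = (G₁ : Set G) := by
  simp_rw [normalizer_mul_kernel_eq_iff, FinSubgroup.conjugatesFiniteSubgroups_iff]
  constructor
  · intro h K _
    have hnonneg : ∀ g ∈ G₁, 0 ≤ χ (Additive.ofMul g) →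
        ∃ n ∈ G₁, K = MulAut.conj n • K ∧ χ (Additive.ofMul n) = χ (Additive.ofMul g) := by
      intro g hg hχ
      obtain ⟨H₁, hH₁⟩ := FinSubgroup.exists_toSubgroup_eq (χ := χ) K (hfin K inferInstance)
      have : Finite ((MulAut.conj g)⁻¹ • K : Subgroup G) :=
        Finite.of_equiv K (Subgroup.equivSMul _ K).toEquiv
      obtain ⟨H₂, hH₂⟩ := FinSubgroup.exists_toSubgroup_eq (χ := χ) ((MulAut.conj g)⁻¹ • K)
        (hfin _ this)
      obtain ⟨u, hu, hu0, e⟩ := h H₁ H₂ g hg hχ (by rw [hH₁, hH₂, smul_inv_smul])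
      rw [hH₁, hH₂] at e
      refine ⟨g * u⁻¹, G₁.mul_mem hg (G₁.inv_mem hu), ?_, ?_⟩
      · rw [map_mul, map_inv, mul_smul]
        nth_rw 2 [e]
        rw [inv_smul_smul, smul_inv_smul]
      · rw [RealCharacter.apply_mul, RealCharacter.apply_inv, hu0, neg_zero, add_zero]
    intro g hg
    rcases le_total 0 (χ (Additive.ofMul g)) with hχ | hχ
    · exact hnonneg g hg hχ
    · obtain ⟨n, hn, hK, e⟩ := hnonneg g⁻¹ (G₁.inv_mem hg) (by
        rw [RealCharacter.apply_inv]; exact neg_nonneg.2 hχ)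
      refine ⟨n⁻¹, G₁.inv_mem hn, ?_, ?_⟩
      · rw [map_inv, eq_inv_smul_iff]
        exact hK.symm
      · rw [RealCharacter.apply_inv, e, RealCharacter.apply_inv, neg_neg]
  · intro h H₁ H₂ g hg _ e
    obtain ⟨n, hn, hK, hχ⟩ := h _ H₁.finite_toSubgroup g hg
    refine ⟨n⁻¹ * g, G₁.mul_mem (G₁.inv_mem hn) hg, ?_, ?_⟩
    · rw [RealCharacter.apply_mul, RealCharacter.apply_inv, hχ, neg_add_cancel]
    · rw [map_mul, mul_smul, ← e, map_inv, eq_inv_smul_iff]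
      exact hK.symm

/-- If `χ` takes the same values on every `N_{G₁}(K)` as on `G₁`, then every orbit over `G₁ ∩ G_χ`
is a retract of one of finitely many orbits. -/
theorem exists_finite_retracts {G₁ : Subgroup G} [G₁.FiniteIndex]
    (hG : FinitelyManyConjClassesFiniteSubgroups G)
    (hfin : ∀ K : Subgroup G, Finite K → K ≤ G₁)
    (hK : ∀ K : Subgroup G, Finite K →
      ((Subgroup.normalizer (K : Set G) ⊓ G₁ : Subgroup G) : Set G) *
        ((χ.kernel ⊓ G₁ : Subgroup G) : Set G) = (G₁ : Set G)) :
    ∃ (ι : Type u) (_ : Finite ι) (R : ι → FinSubgroup (χ.monoidOf G₁)),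
      ∀ L : FinSubgroup (χ.monoidOf G₁), ∃ (j : ι) (f : L ⟶ R j) (g : R j ⟶ L), f ≫ g = 𝟙 L := by
  obtain ⟨S, hS, hSfin, hconj⟩ := hG
  have := hS.to_subtype
  have hfinite (j : S × G ⧸ G₁) : Finite (MulAut.conj (j.2.out)⁻¹ • j.1.1 : Subgroup G) := by
    have := hSfin _ j.1.2
    exact Finite.of_equiv j.1.1 (Subgroup.equivSMul _ _).toEquiv
  choose R hR using fun j : S × G ⧸ G₁ =>
    FinSubgroup.exists_toSubgroup_eq (χ := χ) (MulAut.conj (j.2.out)⁻¹ • j.1.1 : Subgroup G)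
      (hfin _ (hfinite j))
  refine ⟨S × G ⧸ G₁, inferInstance, R, fun L => ?_⟩
  obtain ⟨K, hKS, g, hg⟩ := hconj _ L.finite_toSubgroup
  let j : S × G ⧸ G₁ := (⟨K, hKS⟩, (g⁻¹ : G))
  obtain ⟨a, ha⟩ := QuotientGroup.mk_out_eq_mul G₁ g⁻¹
  -- `L` and `R j` are conjugate by an element of `G₁`, which can be moved into the kernel of `χ`
  have hLR : L.toSubgroup = MulAut.conj a.1 • (R j).toSubgroup := by
    rw [hR, hg, ← mul_smul, ← map_mul]
    congr 2
    change g = a.1 * ((g⁻¹ : G) : G ⧸ G₁).out⁻¹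
    rw [ha, mul_inv_rev, inv_inv, mul_inv_cancel_left]
  obtain ⟨n, hn, hnK, hχ⟩ :=
    normalizer_mul_kernel_eq_iff.1 (hK _ L.finite_toSubgroup) a a.2
  have h0 : χ (Additive.ofMul (n⁻¹ * a.1)) = 0 := by
    rw [RealCharacter.apply_mul, RealCharacter.apply_inv, hχ, neg_add_cancel]
  have h0' : χ (Additive.ofMul (n⁻¹ * a.1)⁻¹) = 0 := by
    rw [RealCharacter.apply_inv, h0, neg_zero]
  let h : χ.monoidOf G₁ := ⟨⟨n⁻¹ * a.1, G₁.mul_mem (G₁.inv_mem hn) a.2⟩, h0.ge⟩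
  let h' : χ.monoidOf G₁ := ⟨⟨(n⁻¹ * a.1)⁻¹, G₁.inv_mem h.1.2⟩, h0'.ge⟩
  have hh' : h * h' = 1 := Subtype.ext (Subtype.ext (mul_inv_cancel (n⁻¹ * a.1)))
  have e : L.toSubgroup = MulAut.conj h.1.1 • (R j).toSubgroup := by
    change _ = MulAut.conj (n⁻¹ * a.1) • (R j).toSubgroup
    rw [map_mul, mul_smul, ← hLR, map_inv, eq_inv_smul_iff]
    exact hnK.symm
  have e' : (R j).toSubgroup = MulAut.conj h'.1.1 • L.toSubgroup := by
    rw [e]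
    change _ = MulAut.conj (n⁻¹ * a.1)⁻¹ • MulAut.conj (n⁻¹ * a.1) • (R j).toSubgroup
    rw [map_inv, inv_smul_smul]
  obtain ⟨p, hp⟩ := L.exists_hom (R j) h fun _ =>
    FinSubgroup.exists_mul_eq (FinSubgroup.mul_singleton_eq_iff.2 e)
  obtain ⟨q, hq⟩ := (R j).exists_hom L h' fun _ =>
    FinSubgroup.exists_mul_eq (FinSubgroup.mul_singleton_eq_iff.2 e')
  refine ⟨j, p, q, FinSubgroup.hom_ext ?_⟩
  rw [FinSubgroup.baseImage_comp p q hp, hq, ← mul_smul, hh', one_smul]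
  rfl

/-- For a fixed subgroup `G₁` of finite index, the conditions on the finite subgroups are equivalent
to the conditions on the monoid `G₁ ∩ G_χ` in the definition of the Bredon invariant. -/
theorem bredonFP_iff {G₁ : Subgroup G} [G₁.FiniteIndex]
    (hG : FinitelyManyConjClassesFiniteSubgroups G) (hcomm : commutator G ≤ G₁) (hχ : χ ≠ 0)
    (hfin : ∀ K : Subgroup G, Finite K → K ≤ G₁) :
    ConjugatesFiniteSubgroups (χ.monoidOf G₁) ∧ MonoidIsBredonFP m (χ.monoidOf G₁) ↔
      ∀ K : Subgroup G, Finite K →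
        ((Subgroup.normalizer (K : Set G) ⊓ G₁ : Subgroup G) : Set G) *
          ((χ.kernel ⊓ G₁ : Subgroup G) : Set G) = (G₁ : Set G) ∧
        RestrictionInSigma m χ (Subgroup.normalizer (K : Set G)) := by
  have := Subgroup.Normal.of_commutator_le G hcomm
  constructor
  · rintro ⟨hM, hFP⟩ L hL
    have h1 := (conjugatesFiniteSubgroups_iff_normalizer hfin).1 hM L hL
    refine ⟨h1, ?_⟩
    obtain ⟨K, rfl⟩ := FinSubgroup.exists_toSubgroup_eq (χ := χ) L (hfin L hL)
    obtain ⟨y, hyG, hy⟩ := RealCharacter.exists_pos_of_finiteIndex hχ G₁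
    obtain ⟨n, -, hn, e⟩ := normalizer_mul_kernel_eq_iff.1 h1 y hyG
    have hne := restrict_ne_zero (FinSubgroup.conj_smul_eq_self_iff.1 hn) (e.trans_ne hy.ne')
    exact restrictionInSigma_iff.2 ⟨hne, fun n hn => (K.trivialModuleFP_normalizer_iff hne).1
      (BredonModule.trivialModuleFP_normalizer hM hFP K hn)⟩
  · intro h
    have hM := (conjugatesFiniteSubgroups_iff_normalizer hfin).2 fun K hK => (h K hK).1
    obtain ⟨ι, _, R, hR⟩ := exists_finite_retracts hG hfin fun K hK => (h K hK).1
    refine ⟨hM, BredonModule.monoidIsBredonFP_of_normalizer hM R hR fun K n hn => ?_⟩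
    obtain ⟨hne, hK⟩ := restrictionInSigma_iff.1 (h _ K.finite_toSubgroup).2
    exact (K.trivialModuleFP_normalizer_iff hne).2 (hK n hn)

end Restriction

theorem theoremB (G : Type u) [Group G] [Group.FG G]
    (hG : FinitelyManyConjClassesFiniteSubgroups G)
    (m : ℕ∞) (χ : RealCharacter G) (hχ : χ ≠ 0) :
    (rayOfNeZero ℝ χ hχ ∈ BredonSigma m G ↔
      ∃ G₁ : Subgroup G, G₁.FiniteIndex ∧ commutator G ≤ G₁ ∧
        ∀ K : Subgroup G, Finite K →
          K ≤ G₁ ∧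
          ((Subgroup.normalizer (K : Set G) ⊓ G₁ : Subgroup G) : Set G) *
            ((χ.kernel ⊓ G₁ : Subgroup G) : Set G) = (G₁ : Set G) ∧
          RestrictionInSigma m χ (Subgroup.normalizer (K : Set G))) ∧
    (rayOfNeZero ℝ χ hχ ∈ BredonSigma m G ↔
      ∃ G₁ : Subgroup G, G₁.FiniteIndex ∧ commutator G ≤ G₁ ∧
        ∀ K : Subgroup G, Finite K →
          K ≤ G₁ ∧
          ((Subgroup.normalizer (K : Set G) ⊓ G₁ : Subgroup G) : Set G) *
            ((χ.kernel ⊓ G₁ : Subgroup G) : Set G) = (G₁ : Set G) ∧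
          RestrictionInSigma m χ (Subgroup.centralizer (K : Set G))) := by
  have key : rayOfNeZero ℝ χ hχ ∈ BredonSigma m G ↔
      ∃ G₁ : Subgroup G, G₁.FiniteIndex ∧ commutator G ≤ G₁ ∧
        ∀ K : Subgroup G, Finite K →
          K ≤ G₁ ∧
          ((Subgroup.normalizer (K : Set G) ⊓ G₁ : Subgroup G) : Set G) *
            ((χ.kernel ⊓ G₁ : Subgroup G) : Set G) = (G₁ : Set G) ∧
          RestrictionInSigma m χ (Subgroup.normalizer (K : Set G)) := by
    refine exists_congr fun G₁ => ⟨?_, ?_⟩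
    · rintro ⟨_, hfin, hcomm, hM⟩
      exact ⟨‹_›, hcomm, fun K hK => ⟨hfin K hK, (bredonFP_iff hG hcomm hχ hfin).1 hM K hK⟩⟩
    · rintro ⟨_, hcomm, h⟩
      have hfin (K : Subgroup G) (hK : Finite K) : K ≤ G₁ := (h K hK).1
      exact ⟨‹_›, hfin, hcomm, (bredonFP_iff hG hcomm hχ hfin).2 fun K hK => (h K hK).2⟩
  refine ⟨key, key.trans (exists_congr fun G₁ => and_congr_right fun _ => and_congr_right fun _ =>
    forall₂_congr fun K _ => and_congr_right fun _ => and_congr_right fun _ => ?_)⟩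
  exact (restrictionInSigma_centralizer_iff K).symm
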